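/- **Setting.** Let $D\subseteq[0,r]^d$ be compact, $r>0$. Let $f$ be a sample from the Gaussian process $GP(0,k)$ on $D$, where $k(x,x')\le 1$ and $k(x,x)=1$ on $D$. Let $a,b>0$ be such that for every $L>0$, with probability at least $1-d\,a\,e^{-L^2/b^2}$, $f$ is $L$-Lipschitz on $D$ in the 1-norm. The observations are $y_t=f(x_t)+\epsilon_t$ with $\epsilon_t$ i.i.d. $\mathcal N(0,\sigma^2)$, $\sigma>0$, independent of $f$. Write $\mu_{t-1},\sigma_{t-1}$ for the posterior mean and standard deviation given $(x_i,y_i)_{i=1}^{t-1}$, i.e. $\mu_{n}(x)=\mathbf k_n(x)^\top(\mathbf K_n+\sigma^2 I)^{-1}\mathbf y_{1:n}$ and $\sigma_n^2(x)=k(x,x)-\mathbf k_n(x)^\top(\mathbf K_n+\sigma^2I)^{-1}\mathbf k_n(x)$ with $\mathbf k_n(x)=(k(x_i,x))_{i\le n}$, $\mathbf K_n=(k(x_i,x_j))_{i,j\le n}$. Let $\delta\in(0,1)$, $\pi_t=\pi^2t^2/6$, and $$\beta_t=2\log(4\pi_t/\delta)+4d\log\!\big(d\,t\,b\,r\sqrt{\log(4da/\delta)}\big).$$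 GP-UCB chooses, for every $t\ge1$, as a function of the history $(x_i,y_i)_{i<t}$, a point $x_t\in\arg\max_{x\in D}\,\mu_{t-1}(x)+\beta_t^{1/2}\sigma_{t-1}(x)$. Its instantaneous regret is $r_t=\max_D f-f(x_t)$. **Subproblem.** Fix $n_L>1$, and assume $4da/\delta>1$ and $n_Lda/\delta>1$. Let $\Phi$ be the standard normal distribution function and $$N_t(s)=(rdb)^d\log(n_Lda/\delta)^{d/2}\,t^{sd}+1,\qquad h_t(s)=\frac1{b\sqrt{\log(n_Lda/\delta)}\;t^{s}} .$$ For $t\ge1$ consider the problem of minimizing, over $n_\eta,n_\alpha,s\in\mathbb R$, $$\eta^{1/2}\sigma_{t-1}(x_t)+\alpha^{1/2}\,\sigma\sqrt{\tfrac1{t+\sigma^2}}+t^{-s}$$ subject to $1/n_\eta+1/n_\alpha\le\delta(1-1/n_L)$, $\ \pi_tn_\eta(1-\Phi(\eta^{1/2}))=1$, $\ \pi_tn_\alpha N_t(s)(1-\Phi(\alpha^{1/2}))=1$, $\ \alpha,\eta,s>0$, $\ \alpha^{1/2}\le\beta_t^{1/2}$, $\ n_\eta,n_\alpha>1$ (the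 two equations determine $\eta,\alpha$). **Discretization.** Assume that $D=[0,r]^d$ or, more generally, that for all $t\ge1$ and $s>0$ there is a finite set $\mathbb D_t\subseteq D$ with at most $N_t(s)$ points such that every point of $D$ is within 1-norm distance $h_t(s)$ of $\mathbb D_t$. **Theorem.** (1) With probability at least $1-\delta$, $f$ attains its maximum on $D$ and, simultaneously for all $t\ge 1$ and every solution $(\bar n_{\eta,t},\bar n_{\alpha,t},\bar s_t)$ of the subproblem at iteration $t$, with associated $\bar\eta_t,\bar\alpha_t$, $$r_t\le(\beta_t^{1/2}+\bar\eta_t^{1/2})\,\sigma_{t-1}(x_t)-(\beta_t^{1/2}-\bar\alpha_t^{1/2})\,\sigma\sqrt{\tfrac1{t+\sigma^2}}+t^{-\bar s_t}.$$ (2) If $n_L=4$ and $d\,b\,r\sqrt{\log(4da/\delta)}\ge1$, then for every $t\ge1$ the classical choice $\alpha=\eta=\beta_t$, $s=2$ (with $n_\eta,n_\alpha$ determined by the two equations) is feasible for the subproblem, and at every solution the right-hand side in (1) is at most the classical bound $2\beta_t^{1/2}\sigma_{t-1}(x_t)+1/t^2$. -/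

import Mathlib

open MeasureTheory ProbabilityTheory

noncomputable section

namespace GPUCB

/-- `E` holds on a measurable event of probability at least `p`. -/
def HoldsWithProbAtLeast {Ω : Type*} [MeasurableSpace Ω] (P : Measure Ω) (p : ℝ)
    (E : Ω → Prop) : Prop :=
  ∃ A : Set Ω, MeasurableSet A ∧ ENNReal.ofReal p ≤ P A ∧ ∀ ω ∈ A, E ω

/-- The 1-norm distance on `ℝ^d`. -/
def dist1 {d : ℕ} (x y : Fin d → ℝ) : ℝ := ∑ i, |x i - y i|

/-- The Bayesian setting: compact domain `D ⊆ [0,r]^d`, objective `f` drawn from `GP(0,k)` on `D`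
with `k ≤ 1` and unit variance, Gaussian tail for the Lipschitz constant of `f` (in 1-norm) with
constants `a, b`, and i.i.d. `N(0,σ²)` noise, independent of `f`. -/
structure BayesianSetting {Ω : Type*} [MeasurableSpace Ω] (P : Measure Ω) {d : ℕ}
    (D : Set (Fin d → ℝ)) (r a b σ : ℝ) (k : (Fin d → ℝ) → (Fin d → ℝ) → ℝ)
    (f : (Fin d → ℝ) → Ω → ℝ) (ε : ℕ → Ω → ℝ) : Prop where
  r_pos : 0 < r
  a_pos : 0 < a
  b_pos : 0 < b
  σ_pos : 0 < σ
  compact : IsCompact D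
  subset_box : D ⊆ Set.Icc 0 (fun _ => r)
  kernel_le_one : ∀ x ∈ D, ∀ y ∈ D, k x y ≤ 1
  kernel_diag : ∀ x ∈ D, k x x = 1
  measurable_objective : ∀ x ∈ D, Measurable (f x)
  gaussian : IsGaussianProcess (fun (x : D) (ω : Ω) => f x ω) P
  mean_zero : ∀ x ∈ D, ∫ ω, f x ω ∂P = 0
  covariance_eq : ∀ x ∈ D, ∀ y ∈ D, cov[f x, f y; P] = k x y
  lipschitz : ∀ L : ℝ, 0 < L →
    HoldsWithProbAtLeast P (1 - d * a * Real.exp (-L ^ 2 / b ^ 2))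
      (fun ω => ∀ x ∈ D, ∀ y ∈ D, |f x ω - f y ω| ≤ L * dist1 x y)
  measurable_noise : ∀ t, Measurable (ε t)
  noise_law : ∀ t, P.map (ε t) = gaussianReal 0 (Real.toNNReal (σ ^ 2))
  noise_indep : iIndepFun ε P
  noise_indep_objective :
    IndepFun (fun (ω : Ω) (x : D) => f x ω) (fun (ω : Ω) (t : ℕ) => ε t ω) P

/-! ### Gaussian process posterior -/

/-- The vector `(k(x₁,x), …, k(xₙ,x))`. -/
def kernelVec {E : Type*} (k : E → E → ℝ) {n : ℕ} (X : Fin n → E) (x : E) : Fin n → ℝ :=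
  fun i => k (X i) x

/-- The regularized Gram matrix `K + σ² I`. -/
def regGram {E : Type*} (k : E → E → ℝ) (σ : ℝ) {n : ℕ} (X : Fin n → E) :
    Matrix (Fin n) (Fin n) ℝ :=
  Matrix.of (fun i j => k (X i) (X j)) + σ ^ 2 • (1 : Matrix (Fin n) (Fin n) ℝ)

/-- Posterior mean at `x` given the samples `X` and the observations `y`. -/
def postMean {E : Type*} (k : E → E → ℝ) (σ : ℝ) {n : ℕ} (X : Fin n → E) (y : Fin n → ℝ)
    (x : E) : ℝ :=
  kernelVec k X x ⬝ᵥ ((regGram k σ X)⁻¹).mulVec y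

/-- Posterior variance at `x` given the samples `X`. -/
def postVar {E : Type*} (k : E → E → ℝ) (σ : ℝ) {n : ℕ} (X : Fin n → E) (x : E) : ℝ :=
  k x x - kernelVec k X x ⬝ᵥ ((regGram k σ X)⁻¹).mulVec (kernelVec k X x)

/-- Posterior standard deviation at `x` given the samples `X`. -/
def postSD {E : Type*} (k : E → E → ℝ) (σ : ℝ) {n : ℕ} (X : Fin n → E) (x : E) : ℝ :=
  √(postVar k σ X x)

/-! ### The GP-UCB algorithm. Iterations are `t = 1, 2, 3, …`. -/

/-- The weights `π_t = π² t² / 6`. -/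
def piSeq (t : ℕ) : ℝ := Real.pi ^ 2 * (t : ℝ) ^ 2 / 6

/-- The exploration parameter `β_t`. -/
def beta (d : ℕ) (r a b δ : ℝ) (t : ℕ) : ℝ :=
  2 * Real.log (4 * piSeq t / δ)
    + 4 * d * Real.log (d * t * b * r * √(Real.log (4 * d * a / δ)))

/-- The observation `y_t = f(x_t) + ε_t`. -/
def obs {Ω E : Type*} (f : E → Ω → ℝ) (ε : ℕ → Ω → ℝ) (x : ℕ → Ω → E) (t : ℕ) (ω : Ω) : ℝ :=
  f (x t ω) ω + ε t ω

/-- The queried points `x_1, …, x_{t-1}`. -/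
def samples {Ω E : Type*} (x : ℕ → Ω → E) (t : ℕ) (ω : Ω) : Fin (t - 1) → E :=
  fun i => x (i + 1) ω

/-- The observations `y_1, …, y_{t-1}`. -/
def observations {Ω E : Type*} (f : E → Ω → ℝ) (ε : ℕ → Ω → ℝ) (x : ℕ → Ω → E) (t : ℕ) (ω : Ω) :
    Fin (t - 1) → ℝ :=
  fun i => obs f ε x (i + 1) ω

/-- The σ-algebra `F_{t-1}` generated by the history `(x_i, y_i)`, `1 ≤ i ≤ t - 1`. -/
abbrev historySigma {Ω : Type*} {d : ℕ} (f : (Fin d → ℝ) → Ω → ℝ) (ε : ℕ → Ω → ℝ)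
    (x : ℕ → Ω → (Fin d → ℝ)) (t : ℕ) : MeasurableSpace Ω :=
  MeasurableSpace.comap (fun ω => (samples x t ω, observations f ε x t ω)) inferInstance

/-- The posterior standard deviation `σ_{t-1}(z)`. -/
def sdAt {Ω E : Type*} (k : E → E → ℝ) (σ : ℝ) (x : ℕ → Ω → E) (t : ℕ) (ω : Ω) (z : E) : ℝ :=
  postSD k σ (samples x t ω) z

/-- The acquisition function `UCB_t(z) = μ_{t-1}(z) + β_t^{1/2} σ_{t-1}(z)`. -/
def ucb {Ω : Type*} {d : ℕ} (r a b σ δ : ℝ) (k : (Fin d → ℝ) → (Fin d → ℝ) → ℝ)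
    (f : (Fin d → ℝ) → Ω → ℝ) (ε : ℕ → Ω → ℝ) (x : ℕ → Ω → (Fin d → ℝ)) (t : ℕ) (ω : Ω)
    (z : Fin d → ℝ) : ℝ :=
  postMean k σ (samples x t ω) (observations f ε x t ω) z
    + √(beta d r a b δ t) * sdAt k σ x t ω z

/-- `x` is a run of GP-UCB: for every `t ≥ 1` the query `x_t` is determined by the history up to
`t - 1` and maximizes `UCB_t` over `D`. -/
structure IsGPUCB {Ω : Type*} {d : ℕ} (D : Set (Fin d → ℝ)) (r a b σ δ : ℝ)
    (k : (Fin d → ℝ) → (Fin d → ℝ) → ℝ) (f : (Fin d → ℝ) → Ω → ℝ) (ε : ℕ → Ω → ℝ)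
    (x : ℕ → Ω → (Fin d → ℝ)) : Prop where
  adapted : ∀ t, 1 ≤ t → Measurable[historySigma f ε x t] (x t)
  mem : ∀ t, 1 ≤ t → ∀ ω, x t ω ∈ D
  argmax : ∀ t, 1 ≤ t → ∀ ω, IsMaxOn (ucb r a b σ δ k f ε x t ω) D (x t ω)

/-! ### Discretization and the optimization subproblem -/

/-- The standard normal distribution function `Φ`. -/
def Phi (c : ℝ) : ℝ := cdf (gaussianReal 0 1) c

/-- The (real-relaxed) size `|𝔻_t| = (rdb)^d log(n_L d a/δ)^{d/2} t^{s d} + 1`. -/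
def discSize (d : ℕ) (r a b δ nL : ℝ) (t : ℕ) (s : ℝ) : ℝ :=
  (r * d * b) ^ d * Real.log (nL * d * a / δ) ^ ((d : ℝ) / 2) * (t : ℝ) ^ (s * d) + 1

/-- The resolution `h_t = 1 / (b √(log(n_L d a/δ)) t^s)`. -/
def discRadius (d : ℕ) (a b δ nL : ℝ) (t : ℕ) (s : ℝ) : ℝ :=
  1 / (b * √(Real.log (nL * d * a / δ)) * (t : ℝ) ^ s)

/-- `S` is a discretization `𝔻_t` of `D`: finitely many points of `D`, at most `|𝔻_t|` of them,
such that every point of `D` is within 1-norm distance `h_t` of one of them. -/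
def IsDiscretization {d : ℕ} (D : Set (Fin d → ℝ)) (r a b δ nL : ℝ) (t : ℕ) (s : ℝ)
    (S : Finset (Fin d → ℝ)) : Prop :=
  (S : Set (Fin d → ℝ)) ⊆ D ∧ (S.card : ℝ) ≤ discSize d r a b δ nL t s ∧
    ∀ x ∈ D, ∃ w ∈ S, dist1 x w ≤ discRadius d a b δ nL t s

/-- Values of the decision variables `n_η, n_α, s` together with the `η, α` they determine. -/
structure Params where
  nη : ℝ
  nα : ℝ
  s : ℝ
  η : ℝ
  α : ℝ

/-- The constraints of the subproblem at iteration `t`. -/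
structure Feasible (d : ℕ) (r a b δ nL : ℝ) (t : ℕ) (p : Params) : Prop where
  budget : 1 / p.nη + 1 / p.nα ≤ δ * (1 - 1 / nL)
  tail_η : piSeq t * p.nη * (1 - Phi (√p.η)) = 1
  tail_α : piSeq t * p.nα * discSize d r a b δ nL t p.s * (1 - Phi (√p.α)) = 1
  α_pos : 0 < p.α
  η_pos : 0 < p.η
  s_pos : 0 < p.s
  α_le : √p.α ≤ √(beta d r a b δ t)
  nη_gt : 1 < p.nη
  nα_gt : 1 < p.nα

/-- `c_2(t) = σ √(1/(t+σ²))`. -/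
def c2 (σ : ℝ) (t : ℕ) : ℝ := σ * √(1 / ((t : ℝ) + σ ^ 2))

/-- The objective `η^{1/2} c_1 + α^{1/2} c_2(t) + t^{-s}` of the subproblem. -/
def objective (σ c₁ : ℝ) (t : ℕ) (p : Params) : ℝ :=
  √p.η * c₁ + √p.α * c2 σ t + 1 / (t : ℝ) ^ p.s

/-- `p` solves the subproblem at iteration `t`, with `c₁` the value of `σ_{t-1}(x_t)`. -/
def IsSolution (d : ℕ) (r a b σ δ nL c₁ : ℝ) (t : ℕ) (p : Params) : Prop :=
  Feasible d r a b δ nL t p ∧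
    ∀ q : Params, Feasible d r a b δ nL t q → objective σ c₁ t p ≤ objective σ c₁ t q

/-- The regret bound `(β^{1/2}+η^{1/2}) c_1 - (β^{1/2}-α^{1/2}) σ √(1/(t+σ²)) + t^{-s}`. -/
def newBound (d : ℕ) (r a b σ δ c₁ : ℝ) (t : ℕ) (p : Params) : ℝ :=
  (√(beta d r a b δ t) + √p.η) * c₁
    - (√(beta d r a b δ t) - √p.α) * (σ * √(1 / ((t : ℝ) + σ ^ 2)))
    + 1 / (t : ℝ) ^ p.s

end GPUCB

end

/-! On a good event, compare a maximizer `x*` of `f` with a grid point `w` near it. The Lipschitz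
bound costs `t^(-s)`, the confidence bounds give `f w ≤ μ w + √α sd w` and `f x_t ≥ μ x_t - √η sd
x_t`, and maximality of `x_t` replaces `μ w + √β sd w` by its value at `x_t`. The leftover `-(√β -
√α) sd w` is the gain over the classical bound, because `sd w` is never below `c2`
(`NoisyGP.le_postVar`, `regret_le`). The Lipschitz bound fails with probability at most `δ / nL` and
the confidence bounds of iteration `t` with at most `δ (1 - 1/nL) / π_t`; these add up to `δ`
(`tsum_budget`).

Two points need care. First, queries depend on past noise, so conditional normality of `f` given the
history is not immediate. The joint law of observations and path has density `likelihood` with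
respect to Lebesgue measure times the path law (`NoisyGP.lintegral_responses`), and at a given `y`
this is the likelihood of the fixed design `queries g n y`. Bayes' rule for fixed designs comes from
independence of residual and observations (`NoisyGP.indepFun_residual`) and holds at every `y` by
continuity (`NoisyGP.lintegral_likelihood_mul`), so it carries over to adaptive designs
(`NoisyGP.measure_deviation`).

Second, the solutions of the subproblem vary with the history, with no measurable selection given. A
countable family of feasible parameters is dense for the objective, and the histories split into
measurable cells on each of which one member is `ρ`-optimal (`exists_measurable_partition`). The
cells are disjoint, so using them costs no probability, and `ρ` is sent to zero at the end.
Near-optimality transfers to the regret bound because the bound and the objective differ by a term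
free of the parameters (`newBound_eq`). The same identity yields the comparison with the classical
bound, once the classical choice is known to be feasible (`feasible_classical`). -/

namespace GPUCB

/-! ### Standard normal tails -/

lemma gaussianReal_Ioi (c : ℝ) : gaussianReal 0 1 (Set.Ioi c) = ENNReal.ofReal (1 - Phi c) := by
  rw [← Set.compl_Iic, prob_compl_eq_one_sub measurableSet_Iic, ← ofReal_cdf, Phi,
    ENNReal.ofReal_sub _ (cdf_nonneg _ _), ENNReal.ofReal_one]

lemma one_sub_Phi_nonneg (c : ℝ) : 0 ≤ 1 - Phi c := sub_nonneg.2 (cdf_le_one _ _)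

lemma one_sub_Phi_pos (c : ℝ) : 0 < 1 - Phi c := by
  have : 0 < gaussianReal 0 1 (Set.Ioi c) := by
    have := gaussianReal_absolutelyContinuous' 0 (v := 1) one_ne_zero
    refine pos_iff_ne_zero.2 fun h => ?_
    simpa using this h
  rwa [gaussianReal_Ioi, ENNReal.ofReal_pos] at this

/-- Chernoff's bound: the standard normal law is sub-Gaussian with parameter one. -/
lemma one_sub_Phi_le {c : ℝ} (hc : 0 ≤ c) : 1 - Phi c ≤ Real.exp (-c ^ 2 / 2) := by
  have hs : HasSubgaussianMGF (fun x : ℝ => x) 1 (gaussianReal 0 1) := by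
    refine ⟨fun t => by simpa using integrable_exp_mul_gaussianReal (μ := 0) (v := 1) t,
      fun t => ?_⟩
    have := congrFun (mgf_fun_id_gaussianReal (μ := 0) (v := 1)) t
    simp [this]
  have h := hs.measure_ge_le hc
  refine le_trans ?_ (h.trans (by simp))
  rw [measureReal_def, ← ENNReal.ofReal_le_iff_le_toReal (measure_ne_top _ _), ← gaussianReal_Ioi]
  exact measure_mono fun x (hx : c < x) => hx.le

/-- The upper tail of a centred normal law, in units of its standard deviation. -/
lemma gaussianReal_Ioi_mul {s : ℝ} (hs : 0 < s) {v : NNReal} (hv : (v : ℝ) = s ^ 2) (u : ℝ) :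
    gaussianReal 0 v (Set.Ioi (u * s)) = ENNReal.ofReal (1 - Phi u) := by
  have h := gaussianReal_map_const_mul (μ := 0) (v := 1) s
  have hv' : (⟨s ^ 2, sq_nonneg _⟩ : NNReal) * 1 = v := by
    ext; simp [hv]
  rw [mul_zero] at h
  rw [← hv', ← gaussianReal_Ioi]
  erw [← h]
  rw [Measure.map_apply (by fun_prop) measurableSet_Ioi]
  congr 1
  ext x
  simp only [Set.mem_preimage, Set.mem_Ioi, mul_comm s]
  exact mul_lt_mul_iff_left₀ hs

/-- The lower tail of a centred normal law, in units of its standard deviation. -/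
lemma gaussianReal_Iio_mul {s : ℝ} (hs : 0 < s) {v : NNReal} (hv : (v : ℝ) = s ^ 2) (u : ℝ) :
    gaussianReal 0 v (Set.Iio (-(u * s))) = ENNReal.ofReal (1 - Phi u) := by
  have h := gaussianReal_map_neg (μ := 0) (v := v)
  rw [neg_zero] at h
  rw [← gaussianReal_Ioi_mul hs hv, ← h, Measure.map_apply (by fun_prop) measurableSet_Iio, h]
  congr 1
  ext x
  simp

/-! ### The weights -/

lemma piSeq_pos {t : ℕ} (ht : 1 ≤ t) : 0 < piSeq t := by
  have : (0 : ℝ) < t := by exact_mod_cast ht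
  unfold piSeq; positivity

/-- Euler's value of `ζ(2)`, with the vanishing term at index zero dropped. -/
lemma hasSum_inv_piSeq : HasSum (fun n : ℕ => 1 / piSeq (n + 1)) 1 := by
  have h := (hasSum_nat_add_iff' 1).2 hasSum_zeta_two
  have hp : Real.pi ^ 2 / 6 ≠ 0 := by positivity
  have := h.div_const (Real.pi ^ 2 / 6)
  simp only [Finset.range_one, Finset.sum_singleton, Nat.cast_zero, ne_eq, OfNat.ofNat_ne_zero,
    not_false_eq_true, zero_pow, div_zero, sub_zero, div_self hp] at this
  refine this.congr_fun fun n => ?_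
  simp only [piSeq]
  field_simp

/-! ### The classical parameters are feasible -/

lemma one_le_piSeq {t : ℕ} (ht : 1 ≤ t) : 1 ≤ piSeq t := by
  have h1 : (1 : ℝ) ≤ t := by exact_mod_cast ht
  have := Real.pi_gt_three
  unfold piSeq
  nlinarith [mul_le_mul this.le this.le (by norm_num) (by positivity), sq_nonneg ((t : ℝ) - 1),
    mul_nonneg (sq_nonneg Real.pi) (sub_nonneg.2 (one_le_pow₀ (n := 2) h1))]

lemma dim_pos_of_one_lt {d : ℕ} {c a δ : ℝ} (h : 1 < c * d * a / δ) : 0 < d := by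
  rcases Nat.eq_zero_or_pos d with rfl | h'
  · norm_num at h
  · exact h'

/-- The discretization size in terms of `C = d b r √(log (n_L d a / δ))`. -/
lemma discSize_eq {d : ℕ} {r a b δ nL : ℝ} {t : ℕ}
    (hL : 1 < nL * d * a / δ) (s : ℝ) :
    discSize d r a b δ nL t s
      = (d * b * r * √(Real.log (nL * d * a / δ)) * (t : ℝ) ^ s) ^ d + 1 := by
  have h0 : 0 ≤ Real.log (nL * d * a / δ) := (Real.log_pos hL).le
  have h1 : Real.log (nL * d * a / δ) ^ ((d : ℝ) / 2) = √(Real.log (nL * d * a / δ)) ^ d := by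
    rw [Real.sqrt_eq_rpow, ← Real.rpow_natCast, ← Real.rpow_mul h0]
    congr 1; ring
  have h2 : (t : ℝ) ^ (s * d) = ((t : ℝ) ^ s) ^ d := by
    rw [← Real.rpow_natCast, ← Real.rpow_mul (Nat.cast_nonneg t)]
  rw [discSize, h1, h2]
  ring

lemma discSize_pos {d : ℕ} {r a b δ nL : ℝ} {t : ℕ} (hr : 0 < r) (hb : 0 < b)
    (hL : 1 < nL * d * a / δ) (s : ℝ) : 0 < discSize d r a b δ nL t s := by
  rw [discSize_eq hL]; positivity

/-- The tail equations are solved for `nη` and `nα`, which leaves the budget. The Chernoff bound at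
`√β` is `δ / (4 π_t)` times `(t C)^(-2d)`, and the second factor absorbs the grid size. Both `nη`
and `nα` exceed one because their reciprocals sum to less than one. -/
lemma feasible_classical {d : ℕ} {r a b δ : ℝ} (hr : 0 < r) (hb : 0 < b)
    (hδ₀ : 0 < δ) (hδ₁ : δ < 1) (hL : 1 < 4 * d * a / δ)
    (hC : 1 ≤ d * b * r * √(Real.log (4 * d * a / δ))) {t : ℕ} (ht : 1 ≤ t) :
    ∃ nη nα : ℝ, Feasible d r a b δ 4 t ⟨nη, nα, 2, beta d r a b δ t, beta d r a b δ t⟩ := by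
  set C := d * b * r * √(Real.log (4 * d * a / δ)) with hCdef
  set β := beta d r a b δ t with hβ
  set T := 1 - Phi (√β) with hT
  set N := discSize d r a b δ 4 t 2 with hN
  have hπ := piSeq_pos ht
  have hπ1 := one_le_piSeq ht
  have ht1 : (1 : ℝ) ≤ t := by exact_mod_cast ht
  have htC : 1 ≤ t * C := one_le_mul_of_one_le_of_one_le ht1 hC
  have hβeq : β = 2 * Real.log (4 * piSeq t / δ) + 4 * d * Real.log (t * C) := by
    rw [hβ, beta, hCdef]; ring_nf
  have hx : 1 < 4 * piSeq t / δ := by rw [lt_div_iff₀ hδ₀]; linarith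
  have hβpos : 0 < β := by
    have := Real.log_pos hx
    have := Real.log_nonneg htC
    rw [hβeq]; positivity
  have hTpos : 0 < T := one_sub_Phi_pos _
  have hNpos : 0 < N := discSize_pos hr hb hL _
  -- From `1 ≤ C` one gets `C t² ≤ (t C)²`, so `N - 1` and each of the two units are at most `(t
  -- C)^(2d)`. The 3 against the 4 inside `β` gives exactly `δ (1 - 1/4)`, hence `nL = 4`.
  have hNle : 1 + N ≤ 3 * (t * C) ^ (2 * d) := by
    have h1 : N = (C * (t : ℝ) ^ (2 : ℝ)) ^ d + 1 := by rw [hN, discSize_eq hL]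
    have h2 : (C * (t : ℝ) ^ (2 : ℝ)) ^ d ≤ (t * C) ^ (2 * d) := by
      rw [pow_mul]
      refine pow_le_pow_left₀ (by positivity) ?_ _
      rw [Real.rpow_two]
      nlinarith [sq_nonneg (t : ℝ), mul_le_mul_of_nonneg_left hC (by positivity : (0:ℝ) ≤ t ^ 2 * C)]
    have h3 : 1 ≤ (t * C) ^ (2 * d) := one_le_pow₀ htC
    linarith
  have hTle : T ≤ δ / (4 * piSeq t) * ((t * C) ^ (2 * d))⁻¹ := by
    refine (one_sub_Phi_le (Real.sqrt_nonneg β)).trans (le_of_eq ?_)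
    rw [Real.sq_sqrt hβpos.le, hβeq,
      show -(2 * Real.log (4 * piSeq t / δ) + 4 * d * Real.log (t * C)) / 2
        = -Real.log (4 * piSeq t / δ) + -((2 * d : ℕ) * Real.log (t * C)) by push_cast; ring,
      Real.exp_add, Real.exp_neg, Real.exp_neg, Real.exp_log (by linarith), Real.exp_nat_mul,
      Real.exp_log (by linarith), inv_div]
  have hsum : piSeq t * T + piSeq t * N * T ≤ δ * (1 - 1 / 4) := by
    calc piSeq t * T + piSeq t * N * T = piSeq t * ((1 + N) * T) := by ring
      _ ≤ piSeq t * (3 * (t * C) ^ (2 * d) * (δ / (4 * piSeq t) * ((t * C) ^ (2 * d))⁻¹)) := by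
          gcongr
      _ = δ * (1 - 1 / 4) := by
          have : (t * C) ^ (2 * d) ≠ 0 := by positivity
          field_simp; ring
  have h1 : 0 < piSeq t * T := by positivity
  have h2 : 0 < piSeq t * N * T := by positivity
  refine ⟨1 / (piSeq t * T), 1 / (piSeq t * N * T), ?_, ?_, ?_, hβpos, hβpos, two_pos, le_rfl,
    ?_, ?_⟩
  · simpa using hsum
  · change piSeq t * (1 / (piSeq t * T)) * T = 1
    field_simp
  · change piSeq t * (1 / (piSeq t * N * T)) * N * T = 1
    field_simp
  · rw [lt_div_iff₀ h1]; linarith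
  · rw [lt_div_iff₀ h2]; linarith

/-- Bound and objective differ by a quantity free of `p`, so exact or approximate minimality for one
passes to the other. -/
lemma newBound_eq (d : ℕ) (r a b σ δ c₁ : ℝ) (t : ℕ) (p : Params) :
    newBound d r a b σ δ c₁ t p
      = √(beta d r a b δ t) * c₁ - √(beta d r a b δ t) * c2 σ t + objective σ c₁ t p := by
  simp only [newBound, objective, c2]; ring

/-- At `α = η = β` the `c2` terms cancel and the bound is the classical one; feasibility makes this
choice a competitor in the minimization. -/
lemma newBound_le_classical {d : ℕ} {r a b σ δ c₁ nη nα : ℝ} {t : ℕ} {p : Params}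
    {nL : ℝ} (hp : IsSolution d r a b σ δ nL c₁ t p)
    (hc : Feasible d r a b δ nL t ⟨nη, nα, 2, beta d r a b δ t, beta d r a b δ t⟩) :
    newBound d r a b σ δ c₁ t p ≤ 2 * √(beta d r a b δ t) * c₁ + 1 / (t : ℝ) ^ 2 := by
  have h := hp.2 _ hc
  rw [newBound_eq]
  simp only [objective, Real.rpow_two] at h ⊢
  linarith

/-! ### Discretization of a cube -/

lemma exists_grid_interval {r : ℝ} (hr : 0 < r) {m : ℕ} (hm : 0 < m) {x : ℝ} (h0 : 0 ≤ x)
    (h1 : x ≤ r) : ∃ i : Fin m, |x - (2 * (i : ℝ) + 1) * (r / (2 * m))| ≤ r / (2 * m) := by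
  have hm' : (0 : ℝ) < m := by exact_mod_cast hm
  set c := r / (2 * m) with hc
  have hc0 : 0 < c := by positivity
  have hrc : r = 2 * m * c := by rw [hc]; field_simp
  -- At `x = r` the floor below would be `m`, outside `Fin m`; the last midpoint serves instead.
  rcases eq_or_lt_of_le h1 with rfl | h1
  · refine ⟨⟨m - 1, by omega⟩, ?_⟩
    simp only [Nat.cast_sub (Nat.one_le_of_lt hm), Nat.cast_one]
    rw [abs_le]; constructor <;> nlinarith
  · have hx : 0 ≤ x / (2 * c) := by positivity
    have hfl := Nat.floor_le hx
    have hlt := Nat.lt_floor_add_one (x / (2 * c))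
    refine ⟨⟨⌊x / (2 * c)⌋₊, ?_⟩, ?_⟩
    · rw [Nat.floor_lt hx, div_lt_iff₀ (by positivity)]; linarith
    · rw [le_div_iff₀ (by positivity)] at hfl
      rw [div_lt_iff₀ (by positivity)] at hlt
      simp only
      rw [abs_le]; constructor <;> linarith

/-- Take the product of cell midpoints, `m` per axis; its 1-norm mesh is `d r / (2m)`, so `2m ≥ M`
is what is needed. Thanks to the factor 2 from centring, `⌈M/2⌉ ≤ M` points per axis suffice when `M
> 2`; otherwise a single point does, paid for by the `+ 1` in the size. -/
lemma exists_isDiscretization_cube {d : ℕ} {r a b δ nL : ℝ} (hr : 0 < r) (hb : 0 < b)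
    (hL : 1 < nL * d * a / δ) {t : ℕ} (ht : 1 ≤ t) (s : ℝ) :
    ∃ S, IsDiscretization (Set.Icc (0 : Fin d → ℝ) (fun _ => r)) r a b δ nL t s S := by
  classical
  have hd : (0 : ℝ) < d := by exact_mod_cast dim_pos_of_one_lt hL
  have ht0 : (0 : ℝ) < t := by exact_mod_cast ht
  set l := √(Real.log (nL * d * a / δ)) with hl
  have hl0 : 0 < l := Real.sqrt_pos.2 (Real.log_pos hL)
  have hts : 0 < (t : ℝ) ^ s := by positivity
  set M := d * b * r * l * (t : ℝ) ^ s with hM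
  have hM0 : 0 < M := by positivity
  obtain ⟨m, hm0, hmM, hmd⟩ : ∃ m : ℕ, 0 < m ∧ M ≤ 2 * m ∧ (m : ℝ) ^ d ≤ M ^ d + 1 := by
    rcases le_or_gt M 2 with h | h
    · exact ⟨1, one_pos, by simpa using h, by simp; positivity⟩
    · refine ⟨⌈M / 2⌉₊, Nat.ceil_pos.2 (by positivity), ?_, ?_⟩
      · linarith [Nat.le_ceil (M / 2)]
      · have := Nat.ceil_lt_add_one (show 0 ≤ M / 2 by positivity)
        have : ((⌈M / 2⌉₊ : ℕ) : ℝ) ^ d ≤ M ^ d := pow_le_pow_left₀ (by positivity) (by linarith) _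
        linarith
  have hm' : (0 : ℝ) < m := by exact_mod_cast hm0
  let pt : (Fin d → Fin m) → Fin d → ℝ := fun i j => (2 * (i j : ℝ) + 1) * (r / (2 * m))
  refine ⟨Finset.univ.image pt, ?_, ?_, ?_⟩
  · intro x hx
    obtain ⟨i, -, rfl⟩ := Finset.mem_image.1 (Finset.mem_coe.1 hx)
    refine ⟨fun j => ?_, fun j => ?_⟩
    · simp only [pt, Pi.zero_apply]; positivity
    · simp only [pt]
      have : ((i j : ℕ) : ℝ) + 1 ≤ m := by exact_mod_cast (i j).2
      calc (2 * ((i j : ℕ) : ℝ) + 1) * (r / (2 * m)) ≤ (2 * m) * (r / (2 * m)) := by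
            gcongr; linarith
        _ = r := by field_simp
  · rw [discSize_eq hL]
    refine le_trans ?_ hmd
    have : (Finset.univ.image pt).card ≤ m ^ d := Finset.card_image_le.trans (by simp)
    exact_mod_cast this
  · intro x hx
    choose i hi using fun j => exists_grid_interval hr hm0 (hx.1 j) (hx.2 j)
    refine ⟨pt i, Finset.mem_image_of_mem _ (Finset.mem_univ _), ?_⟩
    calc dist1 x (pt i) ≤ ∑ _j : Fin d, r / (2 * m) := Finset.sum_le_sum fun j _ => hi j
      _ = d * r / (2 * m) := by simp; ring
      _ ≤ d * r / M := by gcongr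
      _ = discRadius d a b δ nL t s := by
        rw [discRadius, ← hl, hM]; field_simp

/-! ### Noisy Gaussian process models -/

/-- A centred Gaussian process with kernel `K`, unit variance and jointly measurable paths,
presented as `ev x (F ω)` for a random path `F`, together with i.i.d. normal noise `e`
independent of the path. -/
structure NoisyGP {Ω E S : Type*} [MeasurableSpace Ω] [MeasurableSpace E] [MeasurableSpace S]
    (P : Measure Ω) (σ : ℝ) (K : E → E → ℝ) (ev : E → S → ℝ) (F : Ω → S) (e : ℕ → Ω → ℝ) :
    Prop where
  σ_pos : 0 < σ
  measurable_eval : Measurable (Function.uncurry ev)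
  measurable_path : Measurable F
  gaussian : IsGaussianProcess (fun x ω => ev x (F ω)) P
  mean_zero : ∀ x, ∫ ω, ev x (F ω) ∂P = 0
  covariance_eq : ∀ x y, cov[fun ω => ev x (F ω), fun ω => ev y (F ω); P] = K x y
  kernel_le_one : ∀ x y, K x y ≤ 1
  kernel_diag : ∀ x, K x x = 1
  measurable_noise : ∀ n, Measurable (e n)
  noise_law : ∀ n, P.map (e n) = gaussianReal 0 (Real.toNNReal (σ ^ 2))
  noise_indep : iIndepFun e P
  indep : IndepFun F (fun ω n => e n ω) P

/-- The coefficients `(K + σ² I)⁻¹ k(z)` of the posterior mean. -/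
noncomputable def weights {E : Type*} (K : E → E → ℝ) (σ : ℝ) {n : ℕ} (X : Fin n → E) (z : E) :
    Fin n → ℝ :=
  ((regGram K σ X)⁻¹).mulVec (kernelVec K X z)

lemma regGram_mulVec {E : Type*} (K : E → E → ℝ) (σ : ℝ) {n : ℕ} (X : Fin n → E)
    (w : Fin n → ℝ) (i : Fin n) :
    (regGram K σ X).mulVec w i = (∑ j, K (X i) (X j) * w j) + σ ^ 2 * w i := by
  simp [regGram, Matrix.mulVec, dotProduct, add_mul, Finset.sum_add_distrib, Matrix.one_apply]

/-- After multiplication by `q`, the claim is `n` times `h2` plus `v` times `h3`, summed through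
`h1`. Here `q` plays the role of the variance reduction caused by `n` samples. -/
lemma mul_add_le_of_quadratic {n v q A B : ℝ} (hv : 0 ≤ v) (hn : 0 ≤ n) (hB : 0 ≤ B)
    (h1 : q = A + v * B) (h2 : q ^ 2 ≤ A) (h3 : q ^ 2 ≤ B * n) : q * (n + v) ≤ n := by
  have hq : 0 ≤ q := by
    have := (sq_nonneg q).trans h2
    rw [h1]; positivity
  rcases hq.eq_or_lt with h0 | h0
  · rw [← h0]; simpa
  · refine le_of_mul_le_mul_left ?_ h0
    have h4 : n * q ^ 2 ≤ n * A := mul_le_mul_of_nonneg_left h2 hn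
    have h5 : v * q ^ 2 ≤ v * (B * n) := mul_le_mul_of_nonneg_left h3 hv
    calc q * (q * (n + v)) = n * q ^ 2 + v * q ^ 2 := by ring
      _ ≤ n * A + v * (B * n) := add_le_add h4 h5
      _ = n * (A + v * B) := by ring
      _ = q * n := by rw [← h1, mul_comm]

namespace NoisyGP

variable {Ω E S : Type*} [MeasurableSpace Ω] [MeasurableSpace E] [MeasurableSpace S]
  {P : Measure Ω} [IsProbabilityMeasure P] {σ : ℝ} {K : E → E → ℝ} {ev : E → S → ℝ} {F : Ω → S}
  {e : ℕ → Ω → ℝ}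

lemma memLp (h : NoisyGP P σ K ev F e) (x : E) : MemLp (fun ω => ev x (F ω)) 2 P :=
  (h.gaussian.hasGaussianLaw_eval x).memLp_two

lemma noise_hasGaussianLaw (h : NoisyGP P σ K ev F e) (n : ℕ) : HasGaussianLaw (e n) P :=
  ⟨by rw [h.noise_law]; infer_instance⟩

lemma noise_memLp (h : NoisyGP P σ K ev F e) (n : ℕ) : MemLp (e n) 2 P :=
  (h.noise_hasGaussianLaw n).memLp_two

lemma kernel_symm (h : NoisyGP P σ K ev F e) (x y : E) : K x y = K y x := by
  rw [← h.covariance_eq, ← h.covariance_eq, covariance_comm]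

/-- The double sum is the variance of a linear combination of process values. -/
lemma sum_kernel_nonneg (h : NoisyGP P σ K ev F e) {ι : Type*} [Fintype ι] (X : ι → E)
    (c : ι → ℝ) : 0 ≤ ∑ i, ∑ j, c i * (c j * K (X i) (X j)) := by
  have hm : ∀ i, MemLp (fun ω => c i * ev (X i) (F ω)) 2 P := fun i => (h.memLp _).const_mul _
  have := covariance_fun_sum_fun_sum hm hm
  simp only [covariance_const_mul_left, covariance_const_mul_right, h.covariance_eq] at this
  rw [covariance_self (memLp_finsetSum _ fun i _ => hm i).1.aemeasurable] at this
  refine (variance_nonneg _ P).trans_eq (this.trans ?_)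
  exact Finset.sum_congr rfl fun i _ => Finset.sum_congr rfl fun j _ => by ring

lemma abs_kernel_le_one (h : NoisyGP P σ K ev F e) (x y : E) : |K x y| ≤ 1 := by
  refine abs_le.2 ⟨?_, h.kernel_le_one x y⟩
  -- The variance of the sum of the two values is `2 + 2 K x y`.
  have := h.sum_kernel_nonneg ![x, y] 1
  simp [Fin.sum_univ_two, h.kernel_diag, h.kernel_symm y x] at this
  linarith

lemma regGram_transpose (h : NoisyGP P σ K ev F e) {n : ℕ} (X : Fin n → E) :
    (regGram K σ X).transpose = regGram K σ X := by
  ext i j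
  simp [regGram, Matrix.one_apply, h.kernel_symm (X j), eq_comm]

lemma regGram_isUnit (h : NoisyGP P σ K ev F e) {n : ℕ} (X : Fin n → E) :
    IsUnit (regGram K σ X) := by
  refine (Matrix.PosDef.of_dotProduct_mulVec_pos ?_ fun c hc => ?_).isUnit
  · rw [Matrix.IsHermitian, Matrix.conjTranspose_eq_transpose_of_trivial, h.regGram_transpose]
  · have h1 := h.sum_kernel_nonneg X c
    have h2 : 0 < ∑ i, c i * c i := by
      simpa [dotProduct] using Matrix.dotProduct_star_self_pos_iff.2 hc
    have h3 : star c ⬝ᵥ (regGram K σ X).mulVec c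
        = (∑ i, ∑ j, c i * (c j * K (X i) (X j))) + σ ^ 2 * ∑ i, c i * c i := by
      simp only [dotProduct, star_trivial, regGram_mulVec, mul_add, Finset.sum_add_distrib,
        Finset.mul_sum]
      congr 1
      · exact Finset.sum_congr rfl fun i _ => Finset.sum_congr rfl fun j _ => by ring
      · exact Finset.sum_congr rfl fun i _ => by ring
    have := h.σ_pos
    rw [h3]; positivity

/-- The normal equations of linear prediction: they make the residual uncorrelated with every
observation. -/
lemma regGram_mulVec_weights (h : NoisyGP P σ K ev F e) {n : ℕ} (X : Fin n → E) (z : E)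
    (i : Fin n) :
    (∑ j, K (X i) (X j) * weights K σ X z j) + σ ^ 2 * weights K σ X z i = K (X i) z := by
  rw [← regGram_mulVec, weights, Matrix.mulVec_mulVec,
    Matrix.mul_nonsing_inv _ ((Matrix.isUnit_iff_isUnit_det _).1 (h.regGram_isUnit X)),
    Matrix.one_mulVec, kernelVec]

lemma postMean_eq (h : NoisyGP P σ K ev F e) {n : ℕ} (X : Fin n → E) (y : Fin n → ℝ) (z : E) :
    postMean K σ X y z = ∑ i, weights K σ X z i * y i := by
  rw [postMean, Matrix.dotProduct_mulVec, ← Matrix.mulVec_transpose, Matrix.transpose_nonsing_inv,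
    h.regGram_transpose]
  rfl

lemma postVar_eq (h : NoisyGP P σ K ev F e) {n : ℕ} (X : Fin n → E) (z : E) :
    postVar K σ X z = 1 - ∑ i, weights K σ X z i * K (X i) z := by
  rw [postVar, h.kernel_diag, dotProduct_comm]
  rfl

/-- The posterior variance is bounded below by its value after repeated sampling of one point. -/
lemma le_postVar (h : NoisyGP P σ K ev F e) {n : ℕ} (X : Fin n → E) (z : E) :
    σ ^ 2 / (n + σ ^ 2) ≤ postVar K σ X z := by
  set w := weights K σ X z with hw
  set q := ∑ i, w i * K (X i) z with hq
  have hσ : 0 < σ ^ 2 := pow_pos h.σ_pos 2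
  have h1 : q = (∑ i, ∑ j, w i * (w j * K (X i) (X j))) + σ ^ 2 * ∑ i, w i ^ 2 := by
    rw [hq, Finset.mul_sum, ← Finset.sum_add_distrib]
    refine Finset.sum_congr rfl fun i _ => ?_
    rw [← h.regGram_mulVec_weights X z i, mul_add, Finset.mul_sum]
    congr 1
    · exact Finset.sum_congr rfl fun j _ => by rw [← hw]; ring
    · rw [← hw]; ring
  -- Positive semidefiniteness at `z, X` with coefficients `-q, w`: the diagonal term `q²` and two
  -- cross terms `-q²` leave the difference of the two sides.
  have h2 : q ^ 2 ≤ ∑ i, ∑ j, w i * (w j * K (X i) (X j)) := by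
    have := h.sum_kernel_nonneg (fun o : Option (Fin n) => o.elim z X) (fun o => o.elim (-q) w)
    simp only [Fintype.sum_option, Option.elim_none, Option.elim_some, h.kernel_diag,
      Finset.sum_add_distrib] at this
    have e1 : ∑ i, -q * (w i * K z (X i)) = -q ^ 2 := by
      rw [← Finset.mul_sum, sq, ← neg_mul, hq]
      simp only [h.kernel_symm z]
    have e2 : ∑ i, w i * (-q * K (X i) z) = -q ^ 2 := by
      rw [sq, ← neg_mul]
      nth_rw 3 [hq]
      rw [Finset.mul_sum]
      exact Finset.sum_congr rfl fun i _ => by ring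
    rw [e1, e2] at this
    linarith
  have h3 : q ^ 2 ≤ (∑ i, w i ^ 2) * n := by
    refine (Finset.sum_mul_sq_le_sq_mul_sq _ _ _).trans ?_
    have : 0 ≤ ∑ i, w i ^ 2 := Finset.sum_nonneg fun i _ => sq_nonneg _
    refine mul_le_mul_of_nonneg_left ?_ this
    refine (Finset.sum_le_sum (g := fun _ => (1 : ℝ)) fun i _ => ?_).trans (by simp)
    exact (sq_le_one_iff_abs_le_one _).2 (h.abs_kernel_le_one _ _)
  rw [h.postVar_eq, ← hw, ← hq, div_le_iff₀ (by positivity)]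
  linarith [mul_add_le_of_quadratic hσ.le (Nat.cast_nonneg n)
    (Finset.sum_nonneg fun i _ => sq_nonneg (w i)) h1 h2 h3]

lemma postVar_pos (h : NoisyGP P σ K ev F e) {n : ℕ} (X : Fin n → E) (z : E) :
    0 < postVar K σ X z := by
  have := h.σ_pos
  exact lt_of_lt_of_le (by positivity) (h.le_postVar X z)

lemma postSD_pos (h : NoisyGP P σ K ev F e) {n : ℕ} (X : Fin n → E) (z : E) :
    0 < postSD K σ X z := Real.sqrt_pos.2 (h.postVar_pos X z)

/-- Iteration `n + 1` has only `n` samples behind it, so the denominator of `c2` has one unit to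
spare. -/
lemma c2_le_postSD (h : NoisyGP P σ K ev F e) {n : ℕ} (X : Fin n → E) (z : E) :
    c2 σ (n + 1) ≤ postSD K σ X z := by
  have hσ := h.σ_pos
  have : c2 σ (n + 1) = √(σ ^ 2 / ((n + 1 : ℕ) + σ ^ 2)) := by
    rw [c2, div_eq_mul_one_div (σ ^ 2), Real.sqrt_mul (by positivity), Real.sqrt_sq hσ.le]
  rw [this]
  refine Real.sqrt_le_sqrt (le_trans ?_ (h.le_postVar X z))
  gcongr
  simp

/-! ### The residual of the posterior mean -/

/-- For fixed query points, the residual of the posterior mean is independent of the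
observations. -/
lemma indepFun_residual (h : NoisyGP P σ K ev F e) {n : ℕ} (X : Fin n → E) (z : E) :
    IndepFun (fun ω => ev z (F ω) - ∑ i, weights K σ X z i * (ev (X i) (F ω) + e i ω))
      (fun ω (i : Fin n) => ev (X i) (F ω) + e i ω) P ∧
    P.map (fun ω => ev z (F ω) - ∑ i, weights K σ X z i * (ev (X i) (F ω) + e i ω))
      = gaussianReal 0 (postVar K σ X z).toNNReal := by
  set w := weights K σ X z with hw
  have hV := h.memLp
  have he := h.noise_memLp
  have hY : ∀ i : Fin n, MemLp (fun ω => ev (X i) (F ω) + e i ω) 2 P :=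
    fun i => (hV _).add (he _)
  have hwY : ∀ i : Fin n, MemLp (fun ω => w i * (ev (X i) (F ω) + e i ω)) 2 P :=
    fun i => (hY i).const_mul _
  have hS : MemLp (fun ω => ∑ i, w i * (ev (X i) (F ω) + e i ω)) 2 P :=
    memLp_finsetSum _ fun i _ => hwY i
  have hmev : ∀ x, Measurable (ev x) := fun x => h.measurable_eval.of_uncurry_left
  have hfe : ∀ x (n : ℕ), cov[fun ω => ev x (F ω), e n; P] = 0 := fun x m =>
    (h.indep.comp (hmev x) (measurable_pi_apply m)).covariance_eq_zero (hV x) (he m)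
  have hfY : ∀ x (i : Fin n),
      cov[fun ω => ev x (F ω), fun ω => ev (X i) (F ω) + e i ω; P] = K x (X i) := fun x i => by
    have := covariance_add_right (hV x) (hV (X i)) (he i)
    rw [hfe, h.covariance_eq, add_zero] at this
    exact this
  have heY : ∀ i j : Fin n,
      cov[e i, fun ω => ev (X j) (F ω) + e j ω; P] = if i = j then σ ^ 2 else 0 := fun i j => by
    have := covariance_add_right (he i) (hV (X j)) (he j)
    rw [covariance_comm, covariance_comm (e i), hfe, zero_add] at this
    rw [covariance_comm]
    refine this.trans ?_
    split_ifs with hij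
    · subst hij
      rw [covariance_self (h.measurable_noise _).aemeasurable]
      have hv := variance_map (X := id) (Y := e i) (μ := P) aemeasurable_id
        (h.measurable_noise _).aemeasurable
      rw [h.noise_law, variance_id_gaussianReal, Real.coe_toNNReal _ (sq_nonneg σ)] at hv
      exact hv.symm
    · exact (h.noise_indep.indepFun (fun hc => hij (Fin.ext hc))).covariance_eq_zero (he i) (he j)
  have hYY : ∀ i j : Fin n,
      cov[fun ω => ev (X i) (F ω) + e i ω, fun ω => ev (X j) (F ω) + e j ω; P]
        = K (X i) (X j) + if i = j then σ ^ 2 else 0 := fun i j => by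
    have := covariance_add_left (hV (X i)) (he i) (hY j)
    rw [hfY, heY] at this
    exact this
  have hZY : ∀ j : Fin n, cov[fun ω => ev z (F ω) - ∑ i, w i * (ev (X i) (F ω) + e i ω),
      fun ω => ev (X j) (F ω) + e j ω; P] = 0 := fun j => by
    rw [covariance_fun_sub_left (hV z) hS (hY j), covariance_fun_sum_left hwY (hY j), hfY]
    simp only [covariance_const_mul_left, hYY]
    rw [sub_eq_zero, h.kernel_symm z, ← h.regGram_mulVec_weights X z j, ← hw]
    simp only [mul_add, Finset.sum_add_distrib, mul_ite, mul_zero, Finset.sum_ite_eq',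
      Finset.mem_univ, if_true]
    congr 1
    · exact Finset.sum_congr rfl fun i _ => by rw [h.kernel_symm (X j)]; ring
    · ring
  have hZW : cov[fun ω => ev z (F ω) - ∑ i, w i * (ev (X i) (F ω) + e i ω),
      fun ω => ev z (F ω); P] = postVar K σ X z := by
    rw [covariance_fun_sub_left (hV z) hS (hV z), covariance_fun_sum_left hwY (hV z),
      h.covariance_eq, h.kernel_diag, h.postVar_eq, ← hw]
    simp only [covariance_const_mul_left]
    congr 1
    exact Finset.sum_congr rfl fun i _ => by rw [covariance_comm, hfY, h.kernel_symm]
  -- joint Gaussianity of the residual and the observations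
  have hG1 : HasGaussianLaw (fun ω (o : Option (Fin n)) => ev (o.elim z X) (F ω)) P := by
    have := (h.gaussian.comp_right (fun o : Option (Fin n) => o.elim z X)).hasGaussianLaw
      Finset.univ
    exact this.map_fun (F := Option (Fin n) → ℝ)
      (ContinuousLinearMap.pi fun o => ContinuousLinearMap.proj ⟨o, Finset.mem_univ o⟩)
  have hG2 : HasGaussianLaw (fun ω (i : Fin n) => e i ω) P :=
    (h.noise_indep.precomp Fin.val_injective).hasGaussianLaw fun i => h.noise_hasGaussianLaw i
  have hind : IndepFun (fun ω (o : Option (Fin n)) => ev (o.elim z X) (F ω))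
      (fun ω (i : Fin n) => e i ω) P :=
    h.indep.comp (φ := fun s (o : Option (Fin n)) => ev (o.elim z X) s)
      (ψ := fun (u : ℕ → ℝ) (i : Fin n) => u i)
      (measurable_pi_lambda _ fun o => hmev _) (by fun_prop)
  have hG := hind.hasGaussianLaw hG1 hG2
  let L₂ : ((Option (Fin n) → ℝ) × (Fin n → ℝ)) →L[ℝ] (Fin n → ℝ) :=
    ContinuousLinearMap.pi fun i =>
      (ContinuousLinearMap.proj (φ := fun _ : Option (Fin n) => ℝ) (some i)).comp
          (ContinuousLinearMap.fst ℝ _ _)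
        + (ContinuousLinearMap.proj (φ := fun _ : Fin n => ℝ) i).comp
          (ContinuousLinearMap.snd ℝ _ _)
  let L₁ : ((Option (Fin n) → ℝ) × (Fin n → ℝ)) →L[ℝ] ℝ :=
    (ContinuousLinearMap.proj (φ := fun _ : Option (Fin n) => ℝ) none).comp
        (ContinuousLinearMap.fst ℝ _ _)
      - ∑ i, w i • (ContinuousLinearMap.proj (φ := fun _ : Fin n => ℝ) i).comp L₂
  have hZ := hG.map_fun ((ContinuousLinearMap.pi fun _ : Unit => L₁).prod L₂)
  have hZ' : HasGaussianLaw (fun ω =>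
      ((fun _ : Unit => ev z (F ω) - ∑ i, w i * (ev (X i) (F ω) + e i ω)),
        (fun i : Fin n => ev (X i) (F ω) + e i ω))) P := by
    refine hZ.congr (ae_of_all _ fun ω => Prod.ext (funext fun _ => ?_) (funext fun i => ?_))
    · simp [L₁, L₂, mul_add]
    · simp [L₂]
  -- For jointly Gaussian families, vanishing cross-covariances mean independence; the residual
  -- enters as a family indexed by `Unit`.
  have hi := hZ'.indepFun_of_covariance_eval
    (X := fun (_ : Unit) ω => ev z (F ω) - ∑ i, w i * (ev (X i) (F ω) + e i ω))
    (Y := fun i ω => ev (X i) (F ω) + e i ω) fun _ j => hZY j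
  refine ⟨hi.comp (measurable_pi_apply ()) measurable_id, ?_⟩
  have hZ1 : HasGaussianLaw
      (fun ω => ev z (F ω) - ∑ i, w i * (ev (X i) (F ω) + e i ω)) P :=
    hZ'.fst.map_fun (ContinuousLinearMap.proj ())
  rw [hZ1.map_eq_gaussianReal]
  congr 2
  · have hYi : ∀ i : Fin n, ∫ ω, ev (X i) (F ω) + e i ω ∂P = 0 := fun i => by
      rw [integral_add ((hV _).integrable one_le_two) ((he _).integrable one_le_two), h.mean_zero,
        zero_add]
      have := integral_map (h.measurable_noise i).aemeasurable (μ := P) (f := id)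
        aestronglyMeasurable_id
      rw [h.noise_law] at this
      simpa using this.symm
    rw [integral_sub ((hV _).integrable one_le_two) (hS.integrable one_le_two), h.mean_zero,
      integral_finsetSum _ fun i _ => (hwY i).integrable one_le_two]
    simp [integral_const_mul, hYi]
  -- Being uncorrelated with the observations, the residual has variance equal to its covariance
  -- with the value at `z`.
  · rw [← covariance_self (hZ1.aemeasurable)]
    have hZm : MemLp (fun ω => ev z (F ω) - ∑ i, w i * (ev (X i) (F ω) + e i ω)) 2 P :=
      (hV z).sub hS
    rw [covariance_fun_sub_right hZm (hV z) hS, hZW, covariance_fun_sum_right hwY hZm]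
    simp [covariance_const_mul_right, hZY]

end NoisyGP

/-! ### Adaptive sampling -/

section Adaptive

variable {Ω E S : Type*}

/-- The points queried by the strategy `g` along the observations `y`. -/
def queries (g : ∀ n : ℕ, (Fin n → E) × (Fin n → ℝ) → E) :
    ∀ n : ℕ, (Fin n → ℝ) → (Fin n → E)
  | 0, _ => Fin.elim0
  | n + 1, y => Fin.snoc (α := fun _ => E) (queries g n (Fin.init y))
      (g n (queries g n (Fin.init y), Fin.init y))

/-- The point queried by the strategy `g` after the observations `y`. -/
def nextQuery (g : ∀ n : ℕ, (Fin n → E) × (Fin n → ℝ) → E) (n : ℕ) (y : Fin n → ℝ) : E :=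
  g n (queries g n y, y)

/-- The observations made by the strategy `g` on the path `s` with noise `u`. -/
def responses (g : ∀ n : ℕ, (Fin n → E) × (Fin n → ℝ) → E) (ev : E → S → ℝ) (s : S)
    (u : ℕ → ℝ) : ∀ n : ℕ, Fin n → ℝ
  | 0 => Fin.elim0
  | n + 1 => Fin.snoc (α := fun _ => ℝ) (responses g ev s u n)
      (ev (nextQuery g n (responses g ev s u n)) s + u n)

lemma queries_succ (g : ∀ n : ℕ, (Fin n → E) × (Fin n → ℝ) → E) (n : ℕ) (y : Fin (n + 1) → ℝ) :
    queries g (n + 1) y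
      = Fin.snoc (α := fun _ => E) (queries g n (Fin.init y)) (nextQuery g n (Fin.init y)) := rfl

/-- Fixed designs are constant strategies, so the density formula for strategies also serves Bayes'
rule for fixed designs. -/
lemma queries_const (X : ℕ → E) (n : ℕ) (y : Fin n → ℝ) :
    queries (fun n _ => X n) n y = fun i : Fin n => X i := by
  induction n with
  | zero => exact funext fun i : Fin 0 => i.elim0
  | succ n ih =>
    rw [queries_succ, ih]
    funext i
    refine Fin.lastCases ?_ (fun j => ?_) i <;> simp [nextQuery]

lemma responses_const (X : ℕ → E) (ev : E → S → ℝ) (s : S) (u : ℕ → ℝ) (n : ℕ) :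
    responses (fun n _ => X n) ev s u n = fun i : Fin n => ev (X i) s + u i := by
  induction n with
  | zero => exact funext fun i : Fin 0 => i.elim0
  | succ n ih =>
    rw [responses, ih]
    funext i
    refine Fin.lastCases ?_ (fun j => ?_) i <;> simp [nextQuery]

/-- Causality: later noise is not read. This is what makes the next noise variable independent of
the history. -/
lemma responses_congr (g : ∀ n : ℕ, (Fin n → E) × (Fin n → ℝ) → E) (ev : E → S → ℝ) (s : S)
    {u v : ℕ → ℝ} {n : ℕ} (h : ∀ i < n, u i = v i) :
    responses g ev s u n = responses g ev s v n := by
  induction n with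
  | zero => rfl
  | succ n ih => rw [responses, responses, ih fun i hi => h i (by omega), h n (by omega)]

variable [MeasurableSpace Ω] [MeasurableSpace E] [MeasurableSpace S]

lemma measurable_snoc {α : Type*} [MeasurableSpace α] {n : ℕ} :
    Measurable fun p : (Fin n → α) × α => Fin.snoc (α := fun _ => α) p.1 p.2 := by
  refine measurable_pi_lambda _ fun i => ?_
  refine Fin.lastCases ?_ (fun j => ?_) i
  · simpa using measurable_snd
  · simpa [Function.comp_def] using (measurable_pi_apply j).comp measurable_fst

lemma measurable_init {n : ℕ} : Measurable fun y : Fin (n + 1) → ℝ => Fin.init y :=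
  measurable_pi_lambda _ fun i => measurable_pi_apply i.castSucc

variable {g : ∀ n : ℕ, (Fin n → E) × (Fin n → ℝ) → E} {ev : E → S → ℝ}

lemma measurable_queries (hg : ∀ n, Measurable (g n)) (n : ℕ) : Measurable (queries g n) := by
  induction n with
  | zero => exact measurable_const
  | succ n ih =>
    have h := ih.comp measurable_init
    exact measurable_snoc.comp (h.prodMk ((hg n).comp (h.prodMk measurable_init)))

lemma measurable_nextQuery (hg : ∀ n, Measurable (g n)) (n : ℕ) : Measurable (nextQuery g n) :=
  (hg n).comp ((measurable_queries hg n).prodMk measurable_id)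

lemma measurable_responses (hg : ∀ n, Measurable (g n)) (hev : Measurable (Function.uncurry ev))
    (n : ℕ) : Measurable fun p : S × (ℕ → ℝ) => responses g ev p.1 p.2 n := by
  induction n with
  | zero => exact measurable_const
  | succ n ih =>
    refine measurable_snoc.comp (ih.prodMk ?_)
    exact (hev.comp (((measurable_nextQuery hg n).comp ih).prodMk measurable_fst)).add
      ((measurable_pi_apply n).comp measurable_snd)

/-- The likelihood of the observations `y` given the path `s`. -/
noncomputable def likelihood (v : NNReal) (ev : E → S → ℝ) {n : ℕ} (X : Fin n → E)
    (y : Fin n → ℝ) (s : S) : ENNReal :=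
  ∏ i, gaussianPDF 0 v (y i - ev (X i) s)

lemma measurable_likelihood (v : NNReal) (hg : ∀ n, Measurable (g n))
    (hev : Measurable (Function.uncurry ev)) (n : ℕ) :
    Measurable fun p : (Fin n → ℝ) × S => likelihood v ev (queries g n p.1) p.1 p.2 := by
  refine Finset.measurable_fun_prod _ fun i _ => (measurable_gaussianPDF 0 v).comp ?_
  refine ((measurable_pi_apply i).comp measurable_fst).sub (hev.comp (Measurable.prodMk ?_
    measurable_snd))
  exact (measurable_pi_apply i).comp ((measurable_queries hg n).comp measurable_fst)

lemma likelihood_snoc (v : NNReal) (n : ℕ) (y : Fin n → ℝ) (u : ℝ) (s : S) :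
    likelihood v ev (queries g (n + 1) (Fin.snoc (α := fun _ => ℝ) y u))
        (Fin.snoc (α := fun _ => ℝ) y u) s
      = likelihood v ev (queries g n y) y s * gaussianPDF 0 v (u - ev (nextQuery g n y) s) := by
  simp only [likelihood, Fin.prod_univ_castSucc, queries_succ, Fin.init_snoc,
    Fin.snoc_castSucc, Fin.snoc_last]

lemma lintegral_pi_snoc {n : ℕ} {G : (Fin (n + 1) → ℝ) → ENNReal} (hG : Measurable G) :
    ∫⁻ y, G y = ∫⁻ y : Fin n → ℝ, ∫⁻ u : ℝ, G (Fin.snoc (α := fun _ => ℝ) y u) := by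
  have h := (volume_preserving_piFinSuccAbove (fun _ : Fin (n + 1) => ℝ) (Fin.last n)).symm
  rw [← h.lintegral_comp hG, Measure.volume_eq_prod,
    lintegral_prod_symm' (fun a => G ((MeasurableEquiv.piFinSuccAbove (fun _ : Fin (n + 1) => ℝ)
      (Fin.last n)).symm a)) (hG.comp (MeasurableEquiv.measurable _))]
  refine lintegral_congr fun y => lintegral_congr fun u => congrArg G ?_
  exact Fin.insertNth_last' u y

lemma lintegral_gaussianReal_add {v : NNReal} (hv : v ≠ 0) {G : ℝ → ENNReal} (hG : Measurable G)
    (m : ℝ) : ∫⁻ u, G (m + u) ∂(gaussianReal 0 v) = ∫⁻ u, gaussianPDF 0 v (u - m) * G u := by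
  have h := lintegral_withDensity_eq_lintegral_mul volume
    (measurable_gaussianPDF 0 v) (hG.comp (measurable_const_add m))
  simp only [Function.comp_apply] at h
  rw [gaussianReal_of_var_ne_zero _ hv, h,
    ← lintegral_add_left_eq_self (fun u => gaussianPDF 0 v (u - m) * G u) m]
  simp

/-- The path together with the first `n` noise variables is independent of the next one. -/
lemma NoisyGP.indepFun_past {P : Measure Ω} [IsProbabilityMeasure P] {σ : ℝ} {K : E → E → ℝ}
    {F : Ω → S} {e : ℕ → Ω → ℝ} (h : NoisyGP P σ K ev F e) (n : ℕ) :
    IndepFun (fun ω => (F ω, fun i : Fin n => e i ω)) (e n) P := by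
  have hA : Measurable fun ω (i : Fin n) => e i ω :=
    measurable_pi_lambda _ fun i => h.measurable_noise i
  have hB := h.measurable_noise n
  have hF := h.measurable_path
  have hAB : IndepFun (fun ω (i : Fin n) => e i ω) (e n) P := by
    have := h.noise_indep.indepFun_finset (Finset.range n) {n} (by simp) h.measurable_noise
    exact this.comp (φ := fun (u : Finset.range n → ℝ) (i : Fin n) => u ⟨i, by simp⟩)
      (ψ := fun u : ({n} : Finset ℕ) → ℝ => u ⟨n, by simp⟩) (by fun_prop) (by fun_prop)
  have hFAB : IndepFun F (fun ω => ((fun i : Fin n => e i ω), e n ω)) P :=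
    h.indep.comp (φ := id) (ψ := fun u : ℕ → ℝ => ((fun i : Fin n => u i), u n))
      measurable_id (by fun_prop)
  have hFA : IndepFun F (fun ω (i : Fin n) => e i ω) P := hFAB.comp measurable_id measurable_fst
  have := Measure.isProbabilityMeasure_map (μ := P) hF.aemeasurable
  have := Measure.isProbabilityMeasure_map (μ := P) hA.aemeasurable
  have := Measure.isProbabilityMeasure_map (μ := P) hB.aemeasurable
  rw [indepFun_iff_map_prod_eq_prod_map_map hA.aemeasurable hB.aemeasurable] at hAB
  -- The law of path, past noise and next noise is a triple product; reassociating it separates the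
  -- first two from the third.
  rw [indepFun_iff_map_prod_eq_prod_map_map hF.aemeasurable (hA.prodMk hB).aemeasurable, hAB,
    ← Measure.prodAssoc_prod] at hFAB
  rw [indepFun_iff_map_prod_eq_prod_map_map hF.aemeasurable hA.aemeasurable] at hFA
  rw [indepFun_iff_map_prod_eq_prod_map_map (hF.prodMk hA).aemeasurable hB.aemeasurable, hFA]
  refine MeasurableEquiv.prodAssoc.map_measurableEquiv_injective ?_
  rw [← hFAB, Measure.map_map (MeasurableEquiv.measurable _) ((hF.prodMk hA).prodMk hB)]
  rfl

/-- The joint law of the observations of an adaptive strategy and the path has density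
`likelihood`. -/
theorem NoisyGP.lintegral_responses {P : Measure Ω} [IsProbabilityMeasure P] {σ : ℝ}
    {K : E → E → ℝ} {F : Ω → S} {e : ℕ → Ω → ℝ} (h : NoisyGP P σ K ev F e)
    (hg : ∀ n, Measurable (g n)) (n : ℕ) {G : (Fin n → ℝ) × S → ENNReal} (hG : Measurable G) :
    ∫⁻ ω, G (responses g ev (F ω) (fun i => e i ω) n, F ω) ∂P
      = ∫⁻ s, (∫⁻ y, likelihood (Real.toNNReal (σ ^ 2)) ev (queries g n y) y s * G (y, s))
          ∂(P.map F) := by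
  set v := Real.toNNReal (σ ^ 2) with hv
  have hv0 : v ≠ 0 := (Real.toNNReal_pos.2 (pow_pos h.σ_pos 2)).ne'
  have hF := h.measurable_path
  have := Measure.isProbabilityMeasure_map (μ := P) hF.aemeasurable
  induction n with
  | zero =>
    have hd : (volume : Measure (Fin 0 → ℝ)) = Measure.dirac default := by
      rw [volume_pi]; exact Measure.pi_of_empty _ _
    simp only [hd, lintegral_dirac, likelihood, Finset.univ_eq_empty, Finset.prod_empty, one_mul]
    rw [lintegral_map (f := fun s => G (default, s))
      (hG.comp (measurable_const.prodMk measurable_id)) hF]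
    refine lintegral_congr fun ω => ?_
    rw [Subsingleton.elim (responses g ev (F ω) (fun i => e i ω) 0) default]
  | succ n ih =>
    -- The responses as a function of the path and the first `n` noise variables alone; the zeros
    -- supplied beyond are never read.
    set R : S × (Fin n → ℝ) → (Fin n → ℝ) := fun p =>
      responses g ev p.1 (fun i => if hi : i < n then p.2 ⟨i, hi⟩ else 0) n with hR
    have hRm : Measurable R := by
      refine (measurable_responses hg h.measurable_eval n).comp (measurable_fst.prodMk ?_)
      refine measurable_pi_lambda _ fun i => ?_
      change Measurable fun c : S × (Fin n → ℝ) => if hi : i < n then c.2 ⟨i, hi⟩ else 0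
      split_ifs with hi
      · exact (measurable_pi_apply (⟨i, hi⟩ : Fin n)).comp measurable_snd
      · exact measurable_const
    have hRe : ∀ ω, responses g ev (F ω) (fun i => e i ω) n = R (F ω, fun i : Fin n => e i ω) :=
      fun ω => responses_congr _ _ _ fun i hi => by simp [hi]
    have hm : Measurable fun ω => (R (F ω, fun i : Fin n => e i ω), F ω) :=
      (hRm.comp (hF.prodMk (measurable_pi_lambda _ fun i => h.measurable_noise i))).prodMk hF
    have hind : IndepFun (fun ω => (R (F ω, fun i : Fin n => e i ω), F ω)) (e n) P :=
      (h.indepFun_past n).comp (hRm.prodMk measurable_fst) measurable_id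
    rw [indepFun_iff_map_prod_eq_prod_map_map hm.aemeasurable (h.measurable_noise n).aemeasurable,
      h.noise_law] at hind
    set H : ((Fin n → ℝ) × S) × ℝ → ENNReal := fun p =>
      G (Fin.snoc (α := fun _ => ℝ) p.1.1 p.2, p.1.2) with hH
    have hHm : Measurable H := hG.comp ((measurable_snoc.comp
      ((measurable_fst.comp measurable_fst).prodMk measurable_snd)).prodMk
      (measurable_snd.comp measurable_fst))
    have hN : Measurable fun p : (Fin n → ℝ) × S => ev (nextQuery g n p.1) p.2 :=
      h.measurable_eval.comp (((measurable_nextQuery hg n).comp measurable_fst).prodMk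
        measurable_snd)
    have hpdf : Measurable fun q : ((Fin n → ℝ) × S) × ℝ =>
        gaussianPDF 0 v (q.2 - ev (nextQuery g n q.1.1) q.1.2) :=
      (measurable_gaussianPDF 0 v).comp (measurable_snd.sub (hN.comp measurable_fst))
    have hsh : Measurable fun q : ((Fin n → ℝ) × S) × ℝ =>
        H (q.1, ev (nextQuery g n q.1.1) q.1.2 + q.2) :=
      hHm.comp (measurable_fst.prodMk ((hN.comp measurable_fst).add measurable_snd))
    have hpH : Measurable fun q : ((Fin n → ℝ) × S) × ℝ =>
        gaussianPDF 0 v (q.2 - ev (nextQuery g n q.1.1) q.1.2) * H q := hpdf.mul hHm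
    have hI : Measurable fun p : (Fin n → ℝ) × S => ∫⁻ u,
        gaussianPDF 0 v (u - ev (nextQuery g n p.1) p.2) * H (p, u) := hpH.lintegral_prod_right'
    calc ∫⁻ ω, G (responses g ev (F ω) (fun i => e i ω) (n + 1), F ω) ∂P
        = ∫⁻ ω, (fun q : ((Fin n → ℝ) × S) × ℝ => H (q.1, ev (nextQuery g n q.1.1) q.1.2 + q.2))
            ((R (F ω, fun i : Fin n => e i ω), F ω), e n ω) ∂P := by
          refine lintegral_congr fun ω => ?_
          simp only [hH, ← hRe, responses]
      _ = ∫⁻ q, H (q.1, ev (nextQuery g n q.1.1) q.1.2 + q.2)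
            ∂((P.map fun ω => (R (F ω, fun i : Fin n => e i ω), F ω)).prod (gaussianReal 0 v)) := by
          rw [← hind, lintegral_map hsh (hm.prodMk (h.measurable_noise n))]
      _ = ∫⁻ p, (∫⁻ u, gaussianPDF 0 v (u - ev (nextQuery g n p.1) p.2) * H (p, u))
            ∂(P.map fun ω => (R (F ω, fun i : Fin n => e i ω), F ω)) := by
          rw [lintegral_prod _ hsh.aemeasurable]
          refine lintegral_congr fun p => ?_
          exact lintegral_gaussianReal_add hv0 (G := fun u => H (p, u))
            (hHm.comp measurable_prodMk_left) (ev (nextQuery g n p.1) p.2)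
      _ = ∫⁻ ω, (fun p : (Fin n → ℝ) × S => ∫⁻ u,
            gaussianPDF 0 v (u - ev (nextQuery g n p.1) p.2) * H (p, u))
            (responses g ev (F ω) (fun i => e i ω) n, F ω) ∂P := by
          rw [lintegral_map hI hm]
          simp only [hRe]
      _ = _ := by
          rw [ih hI]
          refine lintegral_congr fun s => ?_
          rw [lintegral_pi_snoc (G := fun y => likelihood v ev (queries g (n + 1) y) y s * G (y, s))
            (((measurable_likelihood v hg h.measurable_eval (n + 1)).comp
              (measurable_id.prodMk measurable_const)).mul
            (hG.comp (measurable_id.prodMk measurable_const)))]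
          refine lintegral_congr fun y => ?_
          have hpu := hpH.comp (measurable_prodMk_left (x := (y, s)))
          simp only [Function.comp_def] at hpu
          rw [← lintegral_const_mul _ hpu]
          refine lintegral_congr fun u => ?_
          rw [likelihood_snoc, ← mul_assoc]

end Adaptive

/-! ### Measurability of the posterior -/

section MeasurablePosterior

variable {α E : Type*} [MeasurableSpace α] [MeasurableSpace E]

lemma measurable_matrix_det {n : ℕ} {M : α → Matrix (Fin n) (Fin n) ℝ}
    (hM : ∀ i j, Measurable fun a => M a i j) : Measurable fun a => (M a).det := by
  simp only [Matrix.det_apply, Units.smul_def, zsmul_eq_mul]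
  exact Finset.measurable_fun_sum _ fun τ _ =>
    (Finset.measurable_fun_prod _ fun i _ => hM _ _).const_mul _

/-- The adjugate formula, with inverse zero at determinant zero, covers singular matrices as well.
-/
lemma measurable_matrix_inv {n : ℕ} {M : α → Matrix (Fin n) (Fin n) ℝ}
    (hM : ∀ i j, Measurable fun a => M a i j) (i j : Fin n) :
    Measurable fun a => (M a)⁻¹ i j := by
  simp only [Matrix.inv_def, Ring.inverse_eq_inv', Matrix.smul_apply, Matrix.adjugate_apply,
    smul_eq_mul]
  refine (measurable_matrix_det hM).inv.mul (measurable_matrix_det fun k l => ?_)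
  simp only [Matrix.updateRow_apply]
  split_ifs
  · exact measurable_const
  · exact hM _ _

variable {K : E → E → ℝ} {σ : ℝ} {n : ℕ} {X : α → Fin n → E} {y : α → Fin n → ℝ} {z : α → E}

lemma measurable_kernelVec (hK : Measurable (Function.uncurry K)) (hX : Measurable X)
    (hz : Measurable z) (i : Fin n) : Measurable fun a => kernelVec K (X a) (z a) i :=
  hK.comp (((measurable_pi_apply i).comp hX).prodMk hz)

lemma measurable_regGram_inv (hK : Measurable (Function.uncurry K)) (hX : Measurable X)
    (i j : Fin n) : Measurable fun a => (regGram K σ (X a))⁻¹ i j :=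
  measurable_matrix_inv (fun i j => (hK.comp (((measurable_pi_apply i).comp hX).prodMk
    ((measurable_pi_apply j).comp hX))).add measurable_const) i j

lemma measurable_postMean (hK : Measurable (Function.uncurry K)) (hX : Measurable X)
    (hy : Measurable y) (hz : Measurable z) :
    Measurable fun a => postMean K σ (X a) (y a) (z a) := by
  simp only [postMean, dotProduct, Matrix.mulVec]
  exact Finset.measurable_fun_sum _ fun i _ => (measurable_kernelVec hK hX hz i).mul
    (Finset.measurable_fun_sum _ fun j _ => (measurable_regGram_inv hK hX i j).mul
      ((measurable_pi_apply j).comp hy))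

lemma measurable_postSD (hK : Measurable (Function.uncurry K)) (hX : Measurable X)
    (hz : Measurable z) : Measurable fun a => postSD K σ (X a) (z a) := by
  simp only [postSD, postVar, dotProduct, Matrix.mulVec]
  exact ((hK.comp (hz.prodMk hz)).sub
    (Finset.measurable_fun_sum _ fun i _ => (measurable_kernelVec hK hX hz i).mul
      (Finset.measurable_fun_sum _ fun j _ => (measurable_regGram_inv hK hX i j).mul
        (measurable_kernelVec hK hX hz j)))).sqrt

end MeasurablePosterior

/-! ### The posterior law -/

section Posterior

variable {Ω E S : Type*} [MeasurableSpace Ω] [MeasurableSpace E] [MeasurableSpace S]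
  {P : Measure Ω} [IsProbabilityMeasure P] {σ : ℝ} {K : E → E → ℝ} {ev : E → S → ℝ} {F : Ω → S}
  {e : ℕ → Ω → ℝ}

lemma gaussianPDFReal_le (v : NNReal) (x : ℝ) :
    gaussianPDFReal 0 v x ≤ (√(2 * Real.pi * v))⁻¹ := by
  rw [gaussianPDFReal]
  refine mul_le_of_le_one_right (by positivity) (Real.exp_le_one_iff.2 ?_)
  exact div_nonpos_of_nonpos_of_nonneg (neg_nonpos.2 (sq_nonneg _)) (by positivity)

lemma likelihood_eq_ofReal (v : NNReal) {n : ℕ} (X : Fin n → E) (y : Fin n → ℝ) (s : S) :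
    likelihood v ev X y s = ENNReal.ofReal (∏ i, gaussianPDFReal 0 v (y i - ev (X i) s)) := by
  rw [ENNReal.ofReal_prod_of_nonneg fun i _ => gaussianPDFReal_nonneg _ _ _]
  rfl

lemma likelihood_le (v : NNReal) {n : ℕ} (X : Fin n → E) (y : Fin n → ℝ) (s : S) :
    likelihood v ev X y s ≤ ENNReal.ofReal ((√(2 * Real.pi * v))⁻¹ ^ n) := by
  rw [likelihood_eq_ofReal]
  refine ENNReal.ofReal_le_ofReal ?_
  refine (Finset.prod_le_prod (fun i _ => gaussianPDFReal_nonneg _ _ _)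
    fun i _ => gaussianPDFReal_le v _).trans (by simp)

lemma measurable_likelihood_fixed (v : NNReal) (hev : Measurable (Function.uncurry ev)) {n : ℕ}
    (X : Fin n → E) :
    Measurable fun p : (Fin n → ℝ) × S => likelihood v ev X p.1 p.2 := by
  refine Finset.measurable_fun_prod _ fun i _ => (measurable_gaussianPDF 0 v).comp ?_
  exact ((measurable_pi_apply i).comp measurable_fst).sub
    (hev.of_uncurry_left.comp measurable_snd)

/-- Dominated convergence: the integrand is bounded by a constant and continuous in `y` for each
path. It serves to pass from almost every `y` to every `y` in Bayes' rule. -/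
lemma continuous_lintegral_likelihood (κ : Measure S) [IsProbabilityMeasure κ] (v : NNReal)
    (hev : Measurable (Function.uncurry ev)) {n : ℕ} (X : Fin n → E) (z : E)
    (φ : BoundedContinuousFunction ℝ NNReal) {m : (Fin n → ℝ) → ℝ} (hm : Continuous m) :
    Continuous fun y => ∫⁻ s, likelihood v ev X y s * φ (ev z s - m y) ∂κ := by
  refine continuous_iff_continuousAt.2 fun y => ?_
  set C := ENNReal.ofReal ((√(2 * Real.pi * v))⁻¹ ^ n) * (nndist φ 0 : NNReal) with hC
  refine tendsto_lintegral_filter_of_dominated_convergence (fun _ => C)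
    (Filter.Eventually.of_forall fun y => ?_) (Filter.Eventually.of_forall fun y => ?_) ?_ ?_
  · refine ((measurable_likelihood_fixed v hev X).comp measurable_prodMk_left).mul ?_
    exact (φ.continuous.measurable.comp (hev.of_uncurry_left.sub_const _)).coe_nnreal_ennreal
  · refine ae_of_all _ fun s => mul_le_mul' (likelihood_le _ _ _ _) ?_
    have := φ.dist_coe_le_dist (g := 0) (ev z s - m y)
    rw [NNReal.dist_eq] at this
    simp only [BoundedContinuousFunction.coe_zero, Pi.zero_apply, NNReal.coe_zero, sub_zero,
      NNReal.abs_eq] at this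
    exact_mod_cast this
  · simp [hC, ENNReal.mul_eq_top]
  · refine ae_of_all _ fun s => Continuous.tendsto ?_ y
    have : ∀ y, likelihood v ev X y s * φ (ev z s - m y)
        = ENNReal.ofReal ((∏ i, gaussianPDFReal 0 v (y i - ev (X i) s)) * φ (ev z s - m y)) :=
      fun y => by
        rw [likelihood_eq_ofReal, ENNReal.ofReal_mul
          (Finset.prod_nonneg fun i _ => gaussianPDFReal_nonneg _ _ _), ENNReal.ofReal_coe_nnreal]
    simp only [this]
    refine ENNReal.continuous_ofReal.comp ((continuous_finsetProd _ fun i _ => ?_).mul ?_)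
    · simp only [gaussianPDFReal]
      fun_prop
    · exact NNReal.continuous_coe.comp (φ.continuous.comp (continuous_const.sub hm))

/-- Bayes' rule, in density form and for every value of the observations. -/
lemma NoisyGP.lintegral_likelihood_mul (h : NoisyGP P σ K ev F e) {n : ℕ} (X : Fin n → E) (z : E)
    (φ : BoundedContinuousFunction ℝ NNReal) (y : Fin n → ℝ) :
    ∫⁻ s, likelihood (Real.toNNReal (σ ^ 2)) ev X y s * φ (ev z s - postMean K σ X y z) ∂(P.map F)
      = (∫⁻ u, φ u ∂(gaussianReal 0 (postVar K σ X z).toNNReal))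
        * ∫⁻ s, likelihood (Real.toNNReal (σ ^ 2)) ev X y s ∂(P.map F) := by
  set v := Real.toNNReal (σ ^ 2) with hv
  have hF := h.measurable_path
  have hev := h.measurable_eval
  have hevx : ∀ x, Measurable (ev x) := fun x => hev.of_uncurry_left
  have := Measure.isProbabilityMeasure_map (μ := P) hF.aemeasurable
  set N := gaussianReal 0 (postVar K σ X z).toNNReal with hN
  have hc : ∫⁻ u, φ u ∂N ≠ ⊤ := (φ.lintegral_lt_top_of_nnreal N).ne
  have hmc : Continuous fun y => postMean K σ X y z := by
    simp only [h.postMean_eq]; fun_prop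
  have hcont1 := continuous_lintegral_likelihood (P.map F) v hev X z φ hmc
  have hcont0 : Continuous fun y => ∫⁻ s, likelihood v ev X y s ∂(P.map F) := by
    simpa using continuous_lintegral_likelihood (P.map F) v hev X z
      (BoundedContinuousFunction.const ℝ 1) hmc
  have hφm : Measurable fun u => (φ u : ENNReal) := φ.continuous.measurable.coe_nnreal_ennreal
  -- Both sides are continuous in `y`, so equality almost everywhere suffices. Every `y` is needed
  -- later: along a strategy the design varies with `y`, and an exceptional null set would vary with
  -- it.
  refine congrFun ((Continuous.ae_eq_iff_eq (volume : Measure (Fin n → ℝ)) hcont1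
    (ENNReal.continuous_const_mul hc |>.comp hcont0)).1 ?_) y
  refine ae_eq_of_forall_setLIntegral_eq_of_sigmaFinite hcont1.measurable
    ((ENNReal.continuous_const_mul hc).comp hcont0).measurable fun B hB _ => ?_
  have hlik := measurable_likelihood_fixed v hev X
  have hpm : Measurable fun p : (Fin n → ℝ) × S => ev z p.2 - postMean K σ X p.1 z :=
    ((hevx z).comp measurable_snd).sub (hmc.measurable.comp measurable_fst)
  -- the density formula for fixed query points
  have key : ∀ ψ : ℝ → ENNReal, Measurable ψ →
      ∫⁻ ω, ψ (ev z (F ω) - postMean K σ X (fun i => ev (X i) (F ω) + e i ω) z)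
        * B.indicator 1 (fun i => ev (X i) (F ω) + e i ω) ∂P
      = ∫⁻ y in B, (∫⁻ s, likelihood v ev X y s * ψ (ev z s - postMean K σ X y z) ∂(P.map F)) := by
    intro ψ hψ
    -- The design is run as a constant strategy; `z` beyond index `n` is a filler.
    let X' : ℕ → E := fun i => if hi : i < n then X ⟨i, hi⟩ else z
    have hX' : (fun i : Fin n => X' i) = X := by funext i; simp [X']
    have hX'i : ∀ i : Fin n, X' i = X i := fun i => congrFun hX' i
    have hB1 : Measurable (B.indicator (1 : (Fin n → ℝ) → ENNReal)) := measurable_one.indicator hB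
    have hG : Measurable fun p : (Fin n → ℝ) × S =>
        ψ (ev z p.2 - postMean K σ X p.1 z) * B.indicator 1 p.1 :=
      (hψ.comp hpm).mul (hB1.comp measurable_fst)
    have hd := h.lintegral_responses (g := fun n _ => X' n) (fun n => measurable_const) n hG
    simp only [responses_const, queries_const, hX'i, ← hv] at hd
    rw [hd, lintegral_lintegral_swap, ← lintegral_indicator hB]
    · refine lintegral_congr fun y => ?_
      by_cases hy : y ∈ B
      · simp [hy]
      · simp [hy]
    · exact ((hlik.mul hG).comp measurable_swap).aemeasurable
  have hR := h.indepFun_residual X z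
  have hYm : Measurable fun ω (i : Fin n) => ev (X i) (F ω) + e i ω :=
    measurable_pi_lambda _ fun i => ((hevx _).comp hF).add (h.measurable_noise i)
  have hZm : Measurable fun ω =>
      ev z (F ω) - ∑ i, weights K σ X z i * (ev (X i) (F ω) + e i ω) :=
    ((hevx z).comp hF).sub (Finset.measurable_fun_sum _ fun i _ =>
      ((measurable_pi_apply i).comp hYm).const_mul _)
  have hi : IndepFun
      (fun ω => (φ (ev z (F ω) - ∑ i, weights K σ X z i * (ev (X i) (F ω) + e i ω)) : ENNReal))
      (fun ω => B.indicator (1 : (Fin n → ℝ) → ENNReal) (fun i => ev (X i) (F ω) + e i ω)) P :=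
    hR.1.comp hφm (measurable_one.indicator hB)
  have k1 := key (fun u => φ u) hφm
  have k0 := key (fun _ => 1) measurable_const
  simp only [h.postMean_eq] at k1
  replace k1 := (lintegral_mul_eq_lintegral_mul_lintegral_of_indepFun''
    (hφm.comp hZm).aemeasurable ((measurable_one.indicator hB).comp hYm).aemeasurable hi).symm.trans
    k1
  simp only [Function.comp_def] at k1
  simp only [one_mul, mul_one] at k0
  rw [k0, ← lintegral_map (f := fun u => (φ u : ENNReal)) hφm hZm, hR.2] at k1
  simp only [← h.postMean_eq] at k1
  rw [← k1, ← lintegral_const_mul _ hcont0.measurable]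
  rfl

/-- Given the observations, the deviation of the objective from its posterior mean is centred
normal with the posterior variance. -/
lemma NoisyGP.lintegral_likelihood_indicator (h : NoisyGP P σ K ev F e) {n : ℕ} (X : Fin n → E)
    (z : E) (y : Fin n → ℝ) {A : Set ℝ} (hA : MeasurableSet A) :
    ∫⁻ s, likelihood (Real.toNNReal (σ ^ 2)) ev X y s
        * A.indicator 1 (ev z s - postMean K σ X y z) ∂(P.map F)
      = gaussianReal 0 (postVar K σ X z).toNNReal A
        * ∫⁻ s, likelihood (Real.toNNReal (σ ^ 2)) ev X y s ∂(P.map F) := by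
  set v := Real.toNNReal (σ ^ 2) with hv
  have hev := h.measurable_eval
  have := Measure.isProbabilityMeasure_map (μ := P) h.measurable_path.aemeasurable
  have hl := (measurable_likelihood_fixed v hev X).comp (measurable_prodMk_left (x := y))
  simp only [Function.comp_def] at hl
  have hz : Measurable fun s => ev z s - postMean K σ X y z := hev.of_uncurry_left.sub_const _
  set ν := ((P.map F).withDensity fun s => likelihood v ev X y s).map
    (fun s => ev z s - postMean K σ X y z) with hν
  have hνf : ∀ ψ : ℝ → ENNReal, Measurable ψ → ∫⁻ u, ψ u ∂ν
      = ∫⁻ s, likelihood v ev X y s * ψ (ev z s - postMean K σ X y z) ∂(P.map F) :=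
    fun ψ hψ => by
      rw [hν, lintegral_map hψ hz]
      exact lintegral_withDensity_eq_lintegral_mul _ hl (hψ.comp hz)
  have hfin : ∫⁻ s, likelihood v ev X y s ∂(P.map F) ≠ ⊤ := by
    refine ((lintegral_mono fun s => likelihood_le v X y s).trans_lt ?_).ne
    simp
  have : IsFiniteMeasure ν := by
    have := isFiniteMeasure_withDensity hfin
    exact Measure.isFiniteMeasure_map _ _
  -- Finite measures are determined by bounded continuous test functions.
  have heq : ν = (∫⁻ s, likelihood v ev X y s ∂(P.map F)) •
      gaussianReal 0 (postVar K σ X z).toNNReal := by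
    refine ext_of_forall_lintegral_eq_of_IsFiniteMeasure fun φ => ?_
    rw [hνf _ φ.continuous.measurable.coe_nnreal_ennreal, h.lintegral_likelihood_mul,
      lintegral_smul_measure, smul_eq_mul, mul_comm]
  rw [← hνf _ (measurable_one.indicator hA), lintegral_indicator_one hA, heq, Measure.smul_apply,
    smul_eq_mul, mul_comm]

variable {g : ∀ n : ℕ, (Fin n → E) × (Fin n → ℝ) → E}

/-- Along an adaptive strategy, deviations from the posterior mean whose conditional probability
is constant are independent of the history. -/
theorem NoisyGP.measure_deviation (h : NoisyGP P σ K ev F e)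
    (hK : Measurable (Function.uncurry K)) (hg : ∀ n, Measurable (g n)) {n : ℕ}
    {B : Set (Fin n → ℝ)} (hB : MeasurableSet B) {z : (Fin n → ℝ) → E} (hz : Measurable z)
    {T : Set ((Fin n → ℝ) × ℝ)} (hT : MeasurableSet T) {c : ENNReal}
    (hc : ∀ y, gaussianReal 0 (postVar K σ (queries g n y) (z y)).toNNReal (Prod.mk y ⁻¹' T) = c) :
    P {ω | responses g ev (F ω) (fun i => e i ω) n ∈ B ∧
        (responses g ev (F ω) (fun i => e i ω) n,
          ev (z (responses g ev (F ω) (fun i => e i ω) n)) (F ω)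
            - postMean K σ (queries g n (responses g ev (F ω) (fun i => e i ω) n))
              (responses g ev (F ω) (fun i => e i ω) n)
              (z (responses g ev (F ω) (fun i => e i ω) n))) ∈ T}
      = c * P {ω | responses g ev (F ω) (fun i => e i ω) n ∈ B} := by
  set v := Real.toNNReal (σ ^ 2) with hv
  have hF := h.measurable_path
  have hev := h.measurable_eval
  have := Measure.isProbabilityMeasure_map (μ := P) hF.aemeasurable
  have hR : Measurable fun ω => responses g ev (F ω) (fun i => e i ω) n :=
    (measurable_responses hg hev n).comp
      (hF.prodMk (measurable_pi_lambda _ fun i => h.measurable_noise i))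
  have hq := measurable_queries hg n
  have hdev : Measurable fun p : (Fin n → ℝ) × S => (p.1,
      ev (z p.1) p.2 - postMean K σ (queries g n p.1) p.1 (z p.1)) :=
    measurable_fst.prodMk ((hev.comp ((hz.comp measurable_fst).prodMk measurable_snd)).sub
      (measurable_postMean hK (hq.comp measurable_fst) measurable_fst (hz.comp measurable_fst)))
  have hlik := measurable_likelihood v hg hev n
  -- At fixed `y` the design is frozen, so the fixed-design posterior applies under the
  -- `y`-integral. The case `T = univ` then identifies the remaining integral with the probability
  -- of `B`.
  have key : ∀ T : Set ((Fin n → ℝ) × ℝ), MeasurableSet T →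
      P {ω | responses g ev (F ω) (fun i => e i ω) n ∈ B ∧
        (responses g ev (F ω) (fun i => e i ω) n,
          ev (z (responses g ev (F ω) (fun i => e i ω) n)) (F ω)
            - postMean K σ (queries g n (responses g ev (F ω) (fun i => e i ω) n))
              (responses g ev (F ω) (fun i => e i ω) n)
              (z (responses g ev (F ω) (fun i => e i ω) n))) ∈ T}
        = ∫⁻ y in B, gaussianReal 0 (postVar K σ (queries g n y) (z y)).toNNReal (Prod.mk y ⁻¹' T)
          * (∫⁻ s, likelihood v ev (queries g n y) y s ∂(P.map F)) := by
    intro T hT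
    set U : Set ((Fin n → ℝ) × S) := {p | p.1 ∈ B ∧
      (p.1, ev (z p.1) p.2 - postMean K σ (queries g n p.1) p.1 (z p.1)) ∈ T} with hU
    have hUm : MeasurableSet U := (measurable_fst hB).inter (hdev hT)
    have hG : Measurable (U.indicator (1 : (Fin n → ℝ) × S → ENNReal)) :=
      measurable_one.indicator hUm
    have hpre : MeasurableSet {ω | (responses g ev (F ω) (fun i => e i ω) n, F ω) ∈ U} :=
      (hR.prodMk hF) hUm
    refine (lintegral_indicator_one hpre).symm.trans ?_
    refine (h.lintegral_responses hg n hG).trans ?_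
    have hsw : AEMeasurable (Function.uncurry fun s y =>
        likelihood v ev (queries g n y) y s * U.indicator 1 (y, s))
        ((P.map F).prod volume) := ((hlik.mul hG).comp measurable_swap).aemeasurable
    rw [lintegral_lintegral_swap hsw, ← lintegral_indicator hB]
    refine lintegral_congr fun y => ?_
    by_cases hy : y ∈ B
    · rw [Set.indicator_of_mem hy,
        ← h.lintegral_likelihood_indicator _ _ _ (measurable_prodMk_left hT)]
      refine lintegral_congr fun s => ?_
      congr 1
      have : (y, s) ∈ U ↔ ev (z y) s - postMean K σ (queries g n y) y (z y) ∈ Prod.mk y ⁻¹' T :=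
        ⟨fun hs => hs.2, fun hs => ⟨hy, hs⟩⟩
      by_cases hs : (y, s) ∈ U
      · rw [Set.indicator_of_mem hs, Set.indicator_of_mem (this.1 hs)]; rfl
      · rw [Set.indicator_of_notMem hs, Set.indicator_of_notMem (mt this.2 hs)]
    · simp [hy, hU]
  have k0 := key Set.univ MeasurableSet.univ
  simp only [Set.mem_univ, and_true, Set.preimage_univ, measure_univ, one_mul] at k0
  rw [key T hT, k0]
  simp only [hc]
  rw [lintegral_const_mul]
  exact Measurable.lintegral_prod_right' (f := fun p : (Fin n → ℝ) × S =>
    likelihood v ev (queries g n p.1) p.1 p.2) hlik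

/-- Upper deviations of the objective from its posterior mean. -/
theorem NoisyGP.measure_upper_deviation (h : NoisyGP P σ K ev F e)
    (hK : Measurable (Function.uncurry K)) (hg : ∀ n, Measurable (g n)) {n : ℕ}
    {B : Set (Fin n → ℝ)} (hB : MeasurableSet B) {z : (Fin n → ℝ) → E} (hz : Measurable z)
    (u : ℝ) :
    P {ω | responses g ev (F ω) (fun i => e i ω) n ∈ B ∧
        u * postSD K σ (queries g n (responses g ev (F ω) (fun i => e i ω) n))
            (z (responses g ev (F ω) (fun i => e i ω) n))
          < ev (z (responses g ev (F ω) (fun i => e i ω) n)) (F ω)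
            - postMean K σ (queries g n (responses g ev (F ω) (fun i => e i ω) n))
              (responses g ev (F ω) (fun i => e i ω) n)
              (z (responses g ev (F ω) (fun i => e i ω) n))}
      = ENNReal.ofReal (1 - Phi u) * P {ω | responses g ev (F ω) (fun i => e i ω) n ∈ B} := by
  have hsd := measurable_postSD (σ := σ) hK (measurable_queries hg n) hz
  refine h.measure_deviation hK hg hB hz
    (T := {p | u * postSD K σ (queries g n p.1) (z p.1) < p.2})
    (measurableSet_lt ((hsd.comp measurable_fst).const_mul u) measurable_snd) fun y => ?_
  change gaussianReal 0 _ (Set.Ioi (u * postSD K σ (queries g n y) (z y))) = _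
  refine gaussianReal_Ioi_mul (h.postSD_pos _ _) ?_ u
  rw [postSD, Real.sq_sqrt (h.postVar_pos _ _).le, Real.coe_toNNReal _ (h.postVar_pos _ _).le]

/-- Lower deviations of the objective from its posterior mean. -/
theorem NoisyGP.measure_lower_deviation (h : NoisyGP P σ K ev F e)
    (hK : Measurable (Function.uncurry K)) (hg : ∀ n, Measurable (g n)) {n : ℕ}
    {B : Set (Fin n → ℝ)} (hB : MeasurableSet B) {z : (Fin n → ℝ) → E} (hz : Measurable z)
    (u : ℝ) :
    P {ω | responses g ev (F ω) (fun i => e i ω) n ∈ B ∧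
        ev (z (responses g ev (F ω) (fun i => e i ω) n)) (F ω)
            - postMean K σ (queries g n (responses g ev (F ω) (fun i => e i ω) n))
              (responses g ev (F ω) (fun i => e i ω) n)
              (z (responses g ev (F ω) (fun i => e i ω) n))
          < -(u * postSD K σ (queries g n (responses g ev (F ω) (fun i => e i ω) n))
            (z (responses g ev (F ω) (fun i => e i ω) n)))}
      = ENNReal.ofReal (1 - Phi u) * P {ω | responses g ev (F ω) (fun i => e i ω) n ∈ B} := by
  have hsd := measurable_postSD (σ := σ) hK (measurable_queries hg n) hz
  refine h.measure_deviation hK hg hB hz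
    (T := {p | p.2 < -(u * postSD K σ (queries g n p.1) (z p.1))})
    (measurableSet_lt measurable_snd ((hsd.comp measurable_fst).const_mul u).neg) fun y => ?_
  change gaussianReal 0 _ (Set.Iio (-(u * postSD K σ (queries g n y) (z y)))) = _
  refine gaussianReal_Iio_mul (h.postSD_pos _ _) ?_ u
  rw [postSD, Real.sq_sqrt (h.postVar_pos _ _).le, Real.coe_toNNReal _ (h.postVar_pos _ _).le]

end Posterior

/-! ### Coding continuous paths by their values on a dense sequence -/

/-- A continuous function can be evaluated measurably from its values on a dense sequence. -/
lemma exists_measurable_eval (E : Type*) [PseudoMetricSpace E] [TopologicalSpace.SeparableSpace E]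
    [Nonempty E] [MeasurableSpace E] [OpensMeasurableSpace E] :
    ∃ ev : E → (ℕ → ℝ) → ℝ, Measurable (Function.uncurry ev) ∧
      ∀ φ : E → ℝ, Continuous φ → ∀ x,
        ev x (fun n => φ (TopologicalSpace.denseSeq E n)) = φ x := by
  classical
  set q := TopologicalSpace.denseSeq E with hq
  have hex : ∀ (j : ℕ) (x : E), ∃ n, dist x (q n) < 1 / ((j : ℝ) + 1) := fun j x => by
    have hpos : 0 < 1 / ((j : ℝ) + 1) := by positivity
    simpa using Metric.denseRange_iff.1 (TopologicalSpace.denseRange_denseSeq E) x _ hpos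
  let idx : ℕ → E → ℕ := fun j x => Nat.find (hex j x)
  have hidx : ∀ j, Measurable (idx j) := fun j =>
    measurable_find (hex j) fun n => measurableSet_lt
      ((continuous_id.dist continuous_const).measurable) measurable_const
  -- The `limsup` is measurable over all sequences and is the true limit on those coming from
  -- continuous functions.
  refine ⟨fun x s => Filter.limsup (fun j => s (idx j x)) Filter.atTop, ?_, fun φ hφ x => ?_⟩
  · refine Measurable.limsup (f := fun j (p : E × (ℕ → ℝ)) => p.2 (idx j p.1)) fun j => ?_
    have h : Measurable fun p : ℕ × (ℕ → ℝ) => p.2 p.1 :=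
      measurable_from_prod_countable_right fun n => measurable_pi_apply n
    exact h.comp (((hidx j).comp measurable_fst).prodMk measurable_snd)
  · have hlim : Filter.Tendsto (fun j => q (idx j x)) Filter.atTop (nhds x) := by
      rw [tendsto_iff_dist_tendsto_zero]
      refine squeeze_zero (fun _ => dist_nonneg) (fun j => ?_) tendsto_one_div_add_atTop_nhds_zero_nat
      rw [dist_comm]
      exact (Nat.find_spec (hex j x)).le
    exact ((hφ.tendsto x).comp hlim).limsup_eq

lemma continuous_of_abs_sub_le_dist1 {d : ℕ} {D : Set (Fin d → ℝ)} {φ : (Fin d → ℝ) → ℝ} {L : ℝ}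
    (h : ∀ x ∈ D, ∀ y ∈ D, |φ x - φ y| ≤ L * dist1 x y) : ContinuousOn φ D := by
  intro x hx
  refine tendsto_iff_dist_tendsto_zero.2 (squeeze_zero' (g := fun y => L * dist1 y x)
    (Filter.Eventually.of_forall fun _ => dist_nonneg) ?_ ?_)
  · filter_upwards [self_mem_nhdsWithin] with y hy
    exact h y hy x hx
  · have hc : Continuous fun y : Fin d → ℝ => L * dist1 y x := by
      unfold dist1; fun_prop
    have := (hc.tendsto x).mono_left (nhdsWithin_le_nhds (s := D))
    simpa [dist1] using this

/-- The failure set need not be measurable; it sits inside the complement of the witnessing event.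
-/
lemma measure_compl_le_of_holds {Ω : Type*} [MeasurableSpace Ω] {P : Measure Ω}
    [IsProbabilityMeasure P] {q : ℝ} {E : Ω → Prop}
    (h : HoldsWithProbAtLeast P (1 - q) E) : P {ω | ¬ E ω} ≤ ENNReal.ofReal q := by
  obtain ⟨A, hA, hp, hE⟩ := h
  have hsub : {ω | ¬ E ω} ⊆ Aᶜ := fun ω hω hωA => hω (hE ω hωA)
  refine (measure_mono hsub).trans ?_
  rw [prob_compl_eq_one_sub hA, tsub_le_iff_right]
  calc (1 : ENNReal) = ENNReal.ofReal (q + (1 - q)) := by simp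
    _ ≤ ENNReal.ofReal q + ENNReal.ofReal (1 - q) := ENNReal.ofReal_add_le
    _ ≤ _ := by gcongr

namespace BayesianSetting

variable {Ω : Type*} [MeasurableSpace Ω] {P : Measure Ω} [IsProbabilityMeasure P] {d : ℕ}
  {D : Set (Fin d → ℝ)} {r a b σ : ℝ} {k : (Fin d → ℝ) → (Fin d → ℝ) → ℝ}
  {f : (Fin d → ℝ) → Ω → ℝ} {ε : ℕ → Ω → ℝ}

/-- Almost all sample paths are continuous on the domain. -/
lemma ae_continuousOn (h : BayesianSetting P D r a b σ k f ε) :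
    ∀ᵐ ω ∂P, ContinuousOn (fun x => f x ω) D := by
  have hb := h.b_pos
  have hle : ∀ n : ℕ, P {ω | ¬ ContinuousOn (fun x => f x ω) D}
      ≤ ENNReal.ofReal (d * a * Real.exp (-((n : ℝ) + 1) ^ 2 / b ^ 2)) := fun n => by
    refine le_trans (measure_mono fun ω hω => ?_)
      (measure_compl_le_of_holds (h.lipschitz (n + 1) (by positivity)))
    exact fun hl => hω (continuous_of_abs_sub_le_dist1 hl)
  have hlim : Filter.Tendsto (fun n : ℕ =>
      ENNReal.ofReal (d * a * Real.exp (-((n : ℝ) + 1) ^ 2 / b ^ 2))) Filter.atTop (nhds 0) := by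
    rw [← ENNReal.ofReal_zero]
    refine (ENNReal.continuous_ofReal.tendsto 0).comp ?_
    rw [← mul_zero ((d : ℝ) * a)]
    refine Filter.Tendsto.const_mul _ (Real.tendsto_exp_atBot.comp ?_)
    have h1 : Filter.Tendsto (fun n : ℕ => ((n : ℝ) + 1) ^ 2 / b ^ 2) Filter.atTop Filter.atTop :=
      ((Filter.tendsto_pow_atTop two_ne_zero).comp (Filter.tendsto_atTop_add_const_right _ _
        tendsto_natCast_atTop_atTop)).atTop_div_const (by positivity)
    refine (Filter.tendsto_neg_atTop_atBot.comp h1).congr fun n => ?_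
    simp [neg_div]
  exact le_antisymm (ge_of_tendsto' hlim hle) zero_le

/-- The Bayesian setting as a noisy Gaussian process model whose paths are coded by sequences. -/
lemma exists_noisyGP (h : BayesianSetting P D r a b σ k f ε) (hne : D.Nonempty) :
    ∃ (ev : D → (ℕ → ℝ) → ℝ) (F : Ω → ℕ → ℝ),
      NoisyGP P σ (fun x y : D => k x y) ev F (fun n => ε (n + 1)) ∧
      Measurable (Function.uncurry fun x y : D => k x y) ∧
      ∀ ω, ContinuousOn (fun x => f x ω) D → ∀ x : D, ev x (F ω) = f x ω := by
  have : Nonempty D := hne.to_subtype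
  obtain ⟨ev, hev, hcont⟩ := exists_measurable_eval D
  set q := TopologicalSpace.denseSeq D with hq
  set F : Ω → ℕ → ℝ := fun ω n => f (q n) ω with hF
  have hFm : Measurable F := measurable_pi_lambda _ fun n => h.measurable_objective _ (q n).2
  have hevF : ∀ ω, ContinuousOn (fun x => f x ω) D → ∀ x : D, ev x (F ω) = f x ω :=
    fun ω hω x => hcont (fun x : D => f x ω) (continuousOn_iff_continuous_domRestrict.1 hω) x
  have hae : ∀ x : D, f x =ᵐ[P] fun ω => ev x (F ω) := fun x => by
    filter_upwards [h.ae_continuousOn] with ω hω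
    exact (hevF ω hω x).symm
  have hcov : ∀ x y : D, cov[fun ω => ev x (F ω), fun ω => ev y (F ω); P] = k x y :=
    fun x y => by
      rw [← h.covariance_eq x x.2 y y.2]
      have hx := (integral_congr_ae (hae x)).symm
      have hy := (integral_congr_ae (hae y)).symm
      rw [covariance, covariance, hx, hy]
      refine integral_congr_ae ?_
      filter_upwards [hae x, hae y] with ω h1 h2
      rw [h1, h2]
  have hmean : ∀ x : D, ∫ ω, ev x (F ω) ∂P = 0 := fun x =>
    (integral_congr_ae (hae x).symm).trans (h.mean_zero x x.2)
  have hgauss : IsGaussianProcess (fun (x : D) ω => ev x (F ω)) P := h.gaussian.congr hae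
  refine ⟨ev, F, ?_, ?_, hevF⟩
  · exact
      { σ_pos := h.σ_pos
        measurable_eval := hev
        measurable_path := hFm
        gaussian := hgauss
        mean_zero := hmean
        covariance_eq := hcov
        kernel_le_one := fun x y => h.kernel_le_one x x.2 y y.2
        kernel_diag := fun x => h.kernel_diag x x.2
        measurable_noise := fun n => h.measurable_noise _
        noise_law := fun n => h.noise_law _
        noise_indep := h.noise_indep.precomp (Nat.succ_injective)
        indep := h.noise_indep_objective.comp (φ := fun (φ : D → ℝ) n => φ (q n))
          (ψ := fun (u : ℕ → ℝ) n => u (n + 1)) (by fun_prop) (by fun_prop) }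
  -- Measurability of the kernel is not assumed; it comes from integrating a jointly measurable
  -- function.
  · have hk : ∀ x y : D, k x y = ∫ s, ev x s * ev y s ∂(P.map F) := fun x y => by
      have hm : ∀ x : D, MemLp (fun ω => ev x (F ω)) 2 P := fun x =>
        (hgauss.hasGaussianLaw_eval x).memLp_two
      have hmx : ∀ x : D, Measurable (ev x) := fun x => hev.of_uncurry_left
      rw [← hcov, covariance_eq_sub (hm x) (hm y), hmean, zero_mul, sub_zero,
        integral_map (f := fun s => ev x s * ev y s) hFm.aemeasurable
          ((hmx x).mul (hmx y)).aestronglyMeasurable]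
      rfl
    have hm : Measurable fun p : (D × D) × (ℕ → ℝ) => ev p.1.1 p.2 * ev p.1.2 p.2 :=
      (hev.comp ((measurable_fst.comp measurable_fst).prodMk measurable_snd)).mul
        (hev.comp ((measurable_snd.comp measurable_fst).prodMk measurable_snd))
    have hprob := Measure.isProbabilityMeasure_map (μ := P) hFm.aemeasurable
    have := (hm.stronglyMeasurable.integral_prod_right' (ν := P.map F)).measurable
    simpa only [Function.uncurry_def, hk] using this

end BayesianSetting

/-! ### Adapted queries come from a strategy -/

/-- Queries that follow a strategy are recovered by it from the observations. -/
lemma responses_eq {E S : Type*} {g : ∀ n : ℕ, (Fin n → E) × (Fin n → ℝ) → E} {ev : E → S → ℝ}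
    {s : S} {u : ℕ → ℝ} {X : ℕ → E}
    (hX : ∀ n, X n = g n ((fun i : Fin n => X i), fun i : Fin n => ev (X i) s + u i)) (n : ℕ) :
    responses g ev s u n = (fun i : Fin n => ev (X i) s + u i) ∧
      queries g n (fun i : Fin n => ev (X i) s + u i) = fun i : Fin n => X i := by
  induction n with
  | zero => exact ⟨funext fun i : Fin 0 => i.elim0, funext fun i : Fin 0 => i.elim0⟩
  | succ n ih =>
    have hinit : Fin.init (fun i : Fin (n + 1) => ev (X i) s + u i)
        = fun i : Fin n => ev (X i) s + u i := rfl
    have hnext : nextQuery g n (fun i : Fin n => ev (X i) s + u i) = X n := by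
      rw [nextQuery, ih.2, ← hX]
    constructor
    · rw [responses, ih.1, hnext]
      funext i
      refine Fin.lastCases ?_ (fun j => ?_) i <;> simp
    · rw [queries_succ, hinit, ih.2, hnext]
      funext i
      refine Fin.lastCases ?_ (fun j => ?_) i <;> simp

/-- Doob–Dynkin factorization of the query through the history. Off the histories that occur, the
factor may leave `D`; there it is replaced by a fixed point of `D`. -/
lemma IsGPUCB.exists_strategy {Ω : Type*} {d : ℕ} [Nonempty Ω] {D : Set (Fin d → ℝ)}
    (hD : MeasurableSet D) {r a b σ δ : ℝ}
    {k : (Fin d → ℝ) → (Fin d → ℝ) → ℝ} {f : (Fin d → ℝ) → Ω → ℝ} {ε : ℕ → Ω → ℝ}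
    {x : ℕ → Ω → (Fin d → ℝ)} (hx : IsGPUCB D r a b σ δ k f ε x) :
    ∃ g : ∀ n : ℕ, (Fin n → D) × (Fin n → ℝ) → D, (∀ n, Measurable (g n)) ∧
      ∀ n ω, (⟨x (n + 1) ω, hx.mem _ (by omega) ω⟩ : D)
        = g n ((fun i : Fin n => ⟨x (i + 1) ω, hx.mem _ (by omega) ω⟩),
            fun i : Fin n => obs f ε x (i + 1) ω) := by
  classical
  have hfac : ∀ n : ℕ, ∃ g : (Fin n → D) × (Fin n → ℝ) → D, Measurable g ∧
      ∀ ω, (⟨x (n + 1) ω, hx.mem _ (by omega) ω⟩ : D)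
        = g ((fun i : Fin n => ⟨x (i + 1) ω, hx.mem _ (by omega) ω⟩),
            fun i : Fin n => obs f ε x (i + 1) ω) := fun n => by
    obtain ⟨g, hg, hxg⟩ := (hx.adapted (n + 1) (by omega)).exists_eq_measurable_comp
    have hm : Measurable fun p : (Fin n → D) × (Fin n → ℝ) =>
        g ((fun i => (p.1 i : Fin d → ℝ)), p.2) := hg.comp (by fun_prop)
    let x₀ : D := ⟨x 1 (Classical.arbitrary Ω), hx.mem 1 le_rfl _⟩
    let G : (Fin n → D) × (Fin n → ℝ) → (Fin d → ℝ) := fun p =>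
      if g ((fun i => (p.1 i : Fin d → ℝ)), p.2) ∈ D
        then g ((fun i => (p.1 i : Fin d → ℝ)), p.2) else x₀
    have hGm : Measurable G := Measurable.ite (hm hD) hm measurable_const
    have hGD : ∀ p, G p ∈ D := fun p => by
      by_cases hp : g ((fun i => (p.1 i : Fin d → ℝ)), p.2) ∈ D
      · simpa only [G, if_pos hp] using hp
      · simpa only [G, if_neg hp] using x₀.2
    refine ⟨fun p => ⟨G p, hGD p⟩, hGm.subtype_mk, fun ω => Subtype.ext ?_⟩
    have h1 : x (n + 1) ω = g ((fun i : Fin n => x (i + 1) ω),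
      fun i : Fin n => obs f ε x (i + 1) ω) := congrFun hxg ω
    have h2 : g ((fun i : Fin n => x (i + 1) ω), fun i : Fin n => obs f ε x (i + 1) ω) ∈ D :=
      h1 ▸ hx.mem _ (by omega) ω
    exact h1.trans (if_pos h2).symm
  choose g hg hgx using hfac
  exact ⟨g, hg, hgx⟩

/-! ### Nearly optimal parameters from a countable family -/

/-- The feasible objective functions have a countable dense subfamily. -/
lemma exists_dense_feasible {d : ℕ} {r a b δ nL : ℝ} {t : ℕ} (σ : ℝ)
    (hne : ∃ p, Feasible d r a b δ nL t p) :
    ∃ q : ℕ → Params, (∀ j, Feasible d r a b δ nL t (q j)) ∧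
      ∀ (c : ℝ) (ρ : ℝ), 0 < ρ → ∀ p, Feasible d r a b δ nL t p →
        ∃ j, objective σ c t (q j) ≤ objective σ c t p + ρ := by
  -- The objective is affine in `c` with coefficients `Θ p`, so one dense sequence in a subset of
  -- the plane works for all `c`.
  let Θ : Params → ℝ × ℝ := fun p => (√p.η, √p.α * c2 σ t + 1 / (t : ℝ) ^ p.s)
  let T : Set (ℝ × ℝ) := Θ '' {p | Feasible d r a b δ nL t p}
  have : Nonempty T := by
    obtain ⟨p, hp⟩ := hne
    exact ⟨⟨_, Set.mem_image_of_mem Θ hp⟩⟩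
  choose q hq hqΘ using fun j => (TopologicalSpace.denseSeq T j).2
  refine ⟨q, hq, fun c ρ hρ p hp => ?_⟩
  have hobj : ∀ p, objective σ c t p = (Θ p).1 * c + (Θ p).2 := fun p => by
    simp only [objective, Θ, add_assoc]
  have hcont : Continuous fun v : T => v.1.1 * c + v.1.2 := by fun_prop
  have hopen : IsOpen {v : T | v.1.1 * c + v.1.2 < objective σ c t p + ρ} :=
    isOpen_lt hcont continuous_const
  obtain ⟨j, hj⟩ := (TopologicalSpace.denseRange_denseSeq T).exists_mem_open hopen
    ⟨⟨Θ p, Set.mem_image_of_mem Θ hp⟩, by simp only [Set.mem_ofPred_eq, hobj]; linarith⟩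
  refine ⟨j, ?_⟩
  rw [hobj (q j), hqΘ j]
  exact le_of_lt hj

lemma objective_nonneg {σ c : ℝ} (hσ : 0 ≤ σ) (hc : 0 ≤ c) (t : ℕ) (p : Params) :
    0 ≤ objective σ c t p := by
  unfold objective c2; positivity

/-- A measurable choice of nearly optimal parameters: the history space is partitioned into
countably many pieces on each of which one choice of parameters is nearly optimal. -/
lemma exists_measurable_partition {α : Type*} [MeasurableSpace α] {c : α → ℝ} (hc : Measurable c)
    (hc0 : ∀ y, 0 ≤ c y) {d : ℕ} {r a b δ nL σ : ℝ} (hσ : 0 ≤ σ) {t : ℕ}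
    (hne : ∃ p, Feasible d r a b δ nL t p) {ρ : ℝ} (hρ : 0 < ρ) :
    ∃ (q : ℕ → Params) (B : ℕ → Set α), (∀ j, Feasible d r a b δ nL t (q j)) ∧
      (∀ j, MeasurableSet (B j)) ∧ Pairwise (Function.onFun Disjoint B) ∧ (⋃ j, B j) = Set.univ ∧
      ∀ j, ∀ y ∈ B j, ∀ p, Feasible d r a b δ nL t p →
        objective σ (c y) t (q j) ≤ objective σ (c y) t p + ρ := by
  obtain ⟨q, hq, hdense⟩ := exists_dense_feasible σ hne
  have hm : ∀ j, Measurable fun y => objective σ (c y) t (q j) := fun j => by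
    unfold objective; fun_prop
  -- Half of `ρ` pays for near-minimality within the countable family, the other half for its
  -- density.
  let A : ℕ → Set α := fun j =>
    {y | ∀ i, objective σ (c y) t (q j) ≤ objective σ (c y) t (q i) + ρ / 2}
  have hA : ∀ j, MeasurableSet (A j) := fun j => by
    simp only [A, Set.ofPred_forall]
    exact MeasurableSet.iInter fun i => measurableSet_le (hm j) ((hm i).add_const _)
  refine ⟨q, disjointed A, hq, fun j => MeasurableSet.disjointed hA j, disjoint_disjointed A, ?_,
    fun j y hy p hp => ?_⟩
  · rw [iUnion_disjointed, Set.eq_univ_iff_forall]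
    intro y
    have hbdd : BddBelow (Set.range fun i => objective σ (c y) t (q i)) :=
      ⟨0, by rintro _ ⟨i, rfl⟩; exact objective_nonneg hσ (hc0 y) t _⟩
    obtain ⟨j, hj⟩ := exists_lt_of_ciInf_lt
      (show (⨅ i, objective σ (c y) t (q i)) < (⨅ i, objective σ (c y) t (q i)) + ρ / 2 by linarith)
    exact Set.mem_iUnion.2 ⟨j, fun i => hj.le.trans (by linarith [ciInf_le hbdd i])⟩
  · obtain ⟨i, hi⟩ := hdense (c y) (ρ / 2) (by linarith) p hp
    have := disjointed_subset A j hy i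
    linarith

/-! ### Confidence bounds along a strategy -/

section Confidence

variable {Ω E S : Type*} [MeasurableSpace Ω] [MeasurableSpace E] [MeasurableSpace S]
  {P : Measure Ω} [IsProbabilityMeasure P] {σ : ℝ} {K : E → E → ℝ} {ev : E → S → ℝ} {F : Ω → S}
  {e : ℕ → Ω → ℝ} {g : ∀ n : ℕ, (Fin n → E) × (Fin n → ℝ) → E}

/-- The deviation of the path `s` at `z` from the posterior mean after the observations `y`. -/
noncomputable def deviation (K : E → E → ℝ) (σ : ℝ) (ev : E → S → ℝ)
    (g : ∀ n : ℕ, (Fin n → E) × (Fin n → ℝ) → E) {n : ℕ} (y : Fin n → ℝ) (s : S) (z : E) : ℝ :=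
  ev z s - postMean K σ (queries g n y) y z

/-- Confidence bounds at the next query and at finitely many points, with levels depending on a
measurable partition of the histories. -/
lemma NoisyGP.measure_confidence_failure_le (h : NoisyGP P σ K ev F e)
    (hK : Measurable (Function.uncurry K)) (hg : ∀ n, Measurable (g n)) {n : ℕ}
    {B : ℕ → Set (Fin n → ℝ)} (hB : ∀ j, MeasurableSet (B j))
    (hdisj : Pairwise (Function.onFun Disjoint B)) (u v : ℕ → ℝ) (W : ℕ → Finset E) {p : ENNReal}
    (hp : ∀ j, ENNReal.ofReal (1 - Phi (u j)) + (W j).card * ENNReal.ofReal (1 - Phi (v j)) ≤ p) :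
    P {ω | ∃ j, responses g ev (F ω) (fun i => e i ω) n ∈ B j ∧
        (deviation K σ ev g (responses g ev (F ω) (fun i => e i ω) n) (F ω)
            (nextQuery g n (responses g ev (F ω) (fun i => e i ω) n))
          < -(u j * postSD K σ (queries g n (responses g ev (F ω) (fun i => e i ω) n))
            (nextQuery g n (responses g ev (F ω) (fun i => e i ω) n))) ∨
        ∃ w ∈ W j, v j * postSD K σ (queries g n (responses g ev (F ω) (fun i => e i ω) n)) w
          < deviation K σ ev g (responses g ev (F ω) (fun i => e i ω) n) (F ω) w)} ≤ p := by
  set R : Ω → Fin n → ℝ := fun ω => responses g ev (F ω) (fun i => e i ω) n with hR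
  have hRm : Measurable R := (measurable_responses hg h.measurable_eval n).comp
    (h.measurable_path.prodMk (measurable_pi_lambda _ fun i => h.measurable_noise i))
  let U : ℕ → Set Ω := fun j => {ω | R ω ∈ B j ∧ deviation K σ ev g (R ω) (F ω)
    (nextQuery g n (R ω)) < -(u j * postSD K σ (queries g n (R ω)) (nextQuery g n (R ω)))}
  let V : ℕ → E → Set Ω := fun j w => {ω | R ω ∈ B j ∧
    v j * postSD K σ (queries g n (R ω)) w < deviation K σ ev g (R ω) (F ω) w}
  have hU : ∀ j, P (U j) = ENNReal.ofReal (1 - Phi (u j)) * P (R ⁻¹' B j) := fun j =>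
    h.measure_lower_deviation hK hg (hB j) (measurable_nextQuery hg n) (u j)
  have hV : ∀ j w, P (V j w) = ENNReal.ofReal (1 - Phi (v j)) * P (R ⁻¹' B j) := fun j w =>
    h.measure_upper_deviation hK hg (hB j) (z := fun _ => w) measurable_const (v j)
  calc P {ω | ∃ j, R ω ∈ B j ∧ _}
      ≤ P (⋃ j, U j ∪ ⋃ w ∈ W j, V j w) := by
        refine measure_mono ?_
        rintro ω ⟨j, hj, h1 | ⟨w, hw, h2⟩⟩
        · exact Set.mem_iUnion.2 ⟨j, Or.inl ⟨hj, h1⟩⟩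
        · exact Set.mem_iUnion.2 ⟨j, Or.inr (Set.mem_iUnion₂.2 ⟨w, hw, hj, h2⟩)⟩
    _ ≤ ∑' j, P (U j ∪ ⋃ w ∈ W j, V j w) := measure_iUnion_le _
    _ ≤ ∑' j, p * P (R ⁻¹' B j) := by
        refine ENNReal.tsum_le_tsum fun j => ?_
        calc P (U j ∪ ⋃ w ∈ W j, V j w) ≤ P (U j) + ∑ w ∈ W j, P (V j w) :=
              (measure_union_le _ _).trans (add_le_add le_rfl (measure_biUnion_finset_le _ _))
          _ = (ENNReal.ofReal (1 - Phi (u j)) + (W j).card * ENNReal.ofReal (1 - Phi (v j)))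
                * P (R ⁻¹' B j) := by
              simp only [hU, hV, Finset.sum_const, nsmul_eq_mul]
              ring
          _ ≤ p * P (R ⁻¹' B j) := by gcongr; exact hp j
    -- Disjoint cells: the union over `j` costs `p` in total rather than `p` per cell.
    _ = p * P (⋃ j, R ⁻¹' B j) := by
        rw [ENNReal.tsum_mul_left, measure_iUnion
          (fun i j hij => (hdisj hij).preimage R) fun j => hRm (hB j)]
    _ ≤ p := mul_le_of_le_one_right' prob_le_one

/-- The levels of feasible parameters fit the failure budget of the iteration. -/
lemma Feasible.tail_le {d : ℕ} {r a b δ nL : ℝ} {t : ℕ} {p : Params}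
    (hp : Feasible d r a b δ nL t p) (ht : 1 ≤ t) {m : ℕ}
    (hm : (m : ℝ) ≤ discSize d r a b δ nL t p.s) :
    ENNReal.ofReal (1 - Phi (√p.η)) + m * ENNReal.ofReal (1 - Phi (√p.α))
      ≤ ENNReal.ofReal (1 / piSeq t * (δ * (1 - 1 / nL))) := by
  have hπ := piSeq_pos ht
  have hη : 0 < p.nη := zero_lt_one.trans hp.nη_gt
  have hα : 0 < p.nα := zero_lt_one.trans hp.nα_gt
  have h0 := one_sub_Phi_nonneg (√p.η)
  have h1 := one_sub_Phi_nonneg (√p.α)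
  rw [← ENNReal.ofReal_natCast, ← ENNReal.ofReal_mul (Nat.cast_nonneg _),
    ← ENNReal.ofReal_add h0 (by positivity)]
  refine ENNReal.ofReal_le_ofReal ?_
  have e1 : 1 - Phi (√p.η) = 1 / piSeq t * (1 / p.nη) := by
    have := hp.tail_η
    field_simp
    linarith
  have e2 : discSize d r a b δ nL t p.s * (1 - Phi (√p.α)) = 1 / piSeq t * (1 / p.nα) := by
    have := hp.tail_α
    field_simp
    linarith
  calc 1 - Phi (√p.η) + m * (1 - Phi (√p.α))
      ≤ 1 - Phi (√p.η) + discSize d r a b δ nL t p.s * (1 - Phi (√p.α)) := by gcongr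
    _ = 1 / piSeq t * (1 / p.nη + 1 / p.nα) := by rw [e1, e2]; ring
    _ ≤ _ := by gcongr; exact hp.budget

end Confidence

/-! ### Regret of one iteration -/

/-- The regret bound of one iteration, from the Lipschitz bound and the confidence bounds. -/
lemma regret_le {d : ℕ} {D : Set (Fin d → ℝ)} {r a b σ δ : ℝ}
    {k : (Fin d → ℝ) → (Fin d → ℝ) → ℝ} {φ : (Fin d → ℝ) → ℝ} {n : ℕ} {X : Fin n → Fin d → ℝ}
    {y : Fin n → ℝ} {z xstar w : Fin d → ℝ} {p : Params}
    (hp : √p.α ≤ √(beta d r a b δ (n + 1)))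
    (hargmax : IsMaxOn (fun z => postMean k σ X y z + √(beta d r a b δ (n + 1)) * postSD k σ X z) D z)
    (hw : w ∈ D) (hsd : c2 σ (n + 1) ≤ postSD k σ X w)
    (hLip : φ xstar - φ w ≤ 1 / ((n + 1 : ℕ) : ℝ) ^ p.s)
    (hlow : -(√p.η * postSD k σ X z) ≤ φ z - postMean k σ X y z)
    (hup : φ w - postMean k σ X y w ≤ √p.α * postSD k σ X w) :
    φ xstar - φ z ≤ newBound d r a b σ δ (postSD k σ X z) (n + 1) p := by
  have h1 := hargmax hw
  simp only [Set.mem_ofPred_eq] at h1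
  -- Raising `√α` to the `√β` of the acquisition function leaves `-(√β - √α)` times the deviation at
  -- `w`; the sign constraint lets `c2` replace that deviation.
  have h2 := mul_le_mul_of_nonneg_left hsd (sub_nonneg.2 hp)
  rw [newBound_eq, objective]
  nlinarith

/-! ### Union bound over all iterations -/

lemma mul_discRadius {d : ℕ} {a b δ nL : ℝ} (hb : 0 < b) (hL : 1 < nL * d * a / δ) {t : ℕ}
    (s : ℝ) : b * √(Real.log (nL * d * a / δ)) * discRadius d a b δ nL t s = 1 / (t : ℝ) ^ s := by
  have : 0 < √(Real.log (nL * d * a / δ)) := Real.sqrt_pos.2 (Real.log_pos hL)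
  rw [discRadius]
  field_simp

/-- The share `1/nL` is for the Lipschitz bound; the rest is split by the weights `1/π_t`, which sum
to one. -/
lemma tsum_budget {δ nL : ℝ} (hδ : 0 < δ) (hnL : 1 < nL) :
    ENNReal.ofReal (δ / nL)
      + ∑' n : ℕ, ENNReal.ofReal (1 / piSeq (n + 1) * (δ * (1 - 1 / nL))) = ENNReal.ofReal δ := by
  have h0 : 0 ≤ δ * (1 - 1 / nL) := by
    have : 1 / nL < 1 := by rw [div_lt_one (by linarith)]; exact hnL
    exact mul_nonneg hδ.le (by linarith)
  have hs := hasSum_inv_piSeq.mul_right (δ * (1 - 1 / nL))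
  have hpos : ∀ n : ℕ, 0 ≤ 1 / piSeq (n + 1) * (δ * (1 - 1 / nL)) := fun n =>
    mul_nonneg (one_div_nonneg.2 (piSeq_pos (by omega)).le) h0
  rw [← ENNReal.ofReal_tsum_of_nonneg hpos hs.summable, hs.tsum_eq, one_mul,
    ← ENNReal.ofReal_add (by positivity) h0]
  congr 1
  ring

/-- The regret bound, up to an additive error, with probability at least `1 - δ`. -/
lemma measure_regret_failure_le {Ω : Type*} [MeasurableSpace Ω] {P : Measure Ω}
    [IsProbabilityMeasure P] {d : ℕ} {D : Set (Fin d → ℝ)} {r a b σ δ nL : ℝ}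
    {k : (Fin d → ℝ) → (Fin d → ℝ) → ℝ} {f : (Fin d → ℝ) → Ω → ℝ} {ε : ℕ → Ω → ℝ}
    {x : ℕ → Ω → (Fin d → ℝ)} (hB : BayesianSetting P D r a b σ k f ε)
    (hδ₀ : 0 < δ) (hnL : 1 < nL) (hlogL : 1 < nL * d * a / δ)
    (hD : ∀ t : ℕ, 1 ≤ t → ∀ s : ℝ, 0 < s → ∃ S, IsDiscretization D r a b δ nL t s S)
    (hx : IsGPUCB D r a b σ δ k f ε x) {ρ : ℝ} (hρ : 0 < ρ) :
    P {ω | ¬ (ContinuousOn (fun z => f z ω) D ∧ ∀ xstar ∈ D, ∀ t : ℕ, 1 ≤ t → ∀ p : Params,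
      IsSolution d r a b σ δ nL (sdAt k σ x t ω (x t ω)) t p →
      f xstar ω - f (x t ω) ω
        ≤ newBound d r a b σ δ (sdAt k σ x t ω (x t ω)) t p + ρ)} ≤ ENNReal.ofReal δ := by
  classical
  have : Nonempty Ω := P.nonempty_of_neZero
  have hne : D.Nonempty := ⟨_, hx.mem 1 le_rfl (Classical.arbitrary Ω)⟩
  obtain ⟨ev, F, h, hK, hevF⟩ := hB.exists_noisyGP hne
  obtain ⟨g, hg, hxg⟩ := hx.exists_strategy hB.compact.measurableSet
  set K : D → D → ℝ := fun x y => k x y with hKdef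
  set e : ℕ → Ω → ℝ := fun n => ε (n + 1) with he
  choose! disc hdisc using hD
  set l := √(Real.log (nL * d * a / δ)) with hl
  have hl0 : 0 < l := Real.sqrt_pos.2 (Real.log_pos hlogL)
  have hb := hB.b_pos
  have ha := hB.a_pos
  have hd : (0 : ℝ) < d := by exact_mod_cast dim_pos_of_one_lt hlogL
  -- failure of the confidence bounds in one iteration
  have hconf : ∀ n : ℕ, ∃ Bad : Set Ω,
      P Bad ≤ ENNReal.ofReal (1 / piSeq (n + 1) * (δ * (1 - 1 / nL))) ∧
      ∀ ω, ω ∉ Bad → (∃ p, Feasible d r a b δ nL (n + 1) p) →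
        ∃ q, Feasible d r a b δ nL (n + 1) q ∧
          (∀ p, Feasible d r a b δ nL (n + 1) p →
            objective σ (postSD K σ (queries g n (responses g ev (F ω) (fun i => e i ω) n))
              (nextQuery g n (responses g ev (F ω) (fun i => e i ω) n))) (n + 1) q
            ≤ objective σ (postSD K σ (queries g n (responses g ev (F ω) (fun i => e i ω) n))
              (nextQuery g n (responses g ev (F ω) (fun i => e i ω) n))) (n + 1) p + ρ) ∧
          -(√q.η * postSD K σ (queries g n (responses g ev (F ω) (fun i => e i ω) n))
              (nextQuery g n (responses g ev (F ω) (fun i => e i ω) n)))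
            ≤ deviation K σ ev g (responses g ev (F ω) (fun i => e i ω) n) (F ω)
              (nextQuery g n (responses g ev (F ω) (fun i => e i ω) n)) ∧
          ∀ w ∈ (disc (n + 1) q.s).subtype (· ∈ D),
            deviation K σ ev g (responses g ev (F ω) (fun i => e i ω) n) (F ω) w
              ≤ √q.α * postSD K σ (queries g n (responses g ev (F ω) (fun i => e i ω) n)) w := by
    intro n
    -- Without feasible parameters there is no solution, hence nothing to control.
    by_cases hfeas : ∃ p, Feasible d r a b δ nL (n + 1) p
    swap
    · exact ⟨∅, by simp, fun _ _ hf => absurd hf hfeas⟩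
    obtain ⟨q, B, hq, hBm, hdisj, hcover, hopt⟩ := exists_measurable_partition
      (c := fun y : Fin n → ℝ => postSD K σ (queries g n y) (nextQuery g n y))
      (measurable_postSD hK (measurable_queries hg n) (measurable_nextQuery hg n))
      (fun y => (h.postSD_pos _ _).le) h.σ_pos.le hfeas hρ
    refine ⟨_, h.measure_confidence_failure_le hK hg hBm hdisj (fun j => √(q j).η)
      (fun j => √(q j).α) (fun j => (disc (n + 1) (q j).s).subtype (· ∈ D)) fun j =>
        (hq j).tail_le (by omega) ?_, fun ω hω _ => ?_⟩
    · refine le_trans ?_ (hdisc (n + 1) (by omega) _ (hq j).s_pos).2.1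
      rw [Finset.card_subtype]
      exact_mod_cast Finset.card_filter_le _ _
    · obtain ⟨j, hj⟩ := Set.mem_iUnion.1 (hcover.symm ▸ Set.mem_univ
        (responses g ev (F ω) (fun i => e i ω) n))
      simp only [Set.mem_ofPred_eq, not_exists, not_and, not_or, not_lt] at hω
      exact ⟨q j, hq j, hopt j _ hj, (hω j hj).1, (hω j hj).2⟩
  choose Bad hBad hgood using hconf
  -- failure of the Lipschitz bound
  have hLip : P {ω | ¬ ∀ x ∈ D, ∀ y ∈ D, |f x ω - f y ω| ≤ b * l * dist1 x y}
      ≤ ENNReal.ofReal (δ / nL) := by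
    -- At `L = b l` the tail `d a exp (-L²/b²)` equals `δ / nL`.
    refine (measure_compl_le_of_holds (hB.lipschitz (b * l) (by positivity))).trans_eq ?_
    have hlog := (Real.log_pos hlogL).le
    rw [mul_pow, hl, Real.sq_sqrt hlog, neg_div, mul_div_cancel_left₀ _ (by positivity),
      Real.exp_neg, Real.exp_log (by linarith)]
    congr 1
    field_simp
  have hcont : P {ω | ¬ ContinuousOn (fun z => f z ω) D} = 0 := hB.ae_continuousOn
  refine le_trans (measure_mono (t := {ω | ¬ ContinuousOn (fun z => f z ω) D} ∪
    ({ω | ¬ ∀ x ∈ D, ∀ y ∈ D, |f x ω - f y ω| ≤ b * l * dist1 x y} ∪ ⋃ n, Bad n)) ?_) ?_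
  · intro ω hω
    by_contra hnot
    simp only [Set.mem_union, Set.mem_iUnion, Set.mem_ofPred_eq, not_or, not_not, not_exists]
      at hnot
    obtain ⟨hc, hlip, hbad⟩ := hnot
    refine hω ⟨hc, fun xstar hxs t ht p hp => ?_⟩
    obtain ⟨n, rfl⟩ : ∃ n, t = n + 1 := ⟨t - 1, by omega⟩
    let X : ℕ → D := fun n => ⟨x (n + 1) ω, hx.mem _ (by omega) ω⟩
    have hobs : ∀ i, obs f ε x (i + 1) ω = ev (X i) (F ω) + e i ω := fun i => by
      rw [hevF ω hc]; rfl
    have hX : ∀ n, X n = g n ((fun i : Fin n => X i),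
        fun i : Fin n => ev (X i) (F ω) + e i ω) := fun n => by
      simp only [← hobs]
      exact hxg n ω
    obtain ⟨hR, hQ⟩ :=
      responses_eq (g := g) (ev := ev) (s := F ω) (u := fun i => e i ω) (X := X) hX n
    have hN : nextQuery g n (fun i : Fin n => ev (X i) (F ω) + e i ω) = X n := by
      rw [nextQuery, hQ, ← hX]
    obtain ⟨q, hq, hopt, hlow, hup⟩ := hgood n ω (hbad n) ⟨p, hp.1⟩
    simp only [deviation] at hlow hup
    rw [hR, hQ, hN] at hopt hlow
    rw [hR, hQ] at hup
    obtain ⟨w, hwS, hw⟩ := (hdisc (n + 1) (by omega) _ hq.s_pos).2.2 xstar hxs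
    have hwD : w ∈ D := (hdisc (n + 1) (by omega) _ hq.s_pos).1 hwS
    have hY : observations f ε x (n + 1) ω = fun i : Fin n => ev (X i) (F ω) + e i ω :=
      funext fun i => hobs i
    have hmain : f xstar ω - f (x (n + 1) ω) ω ≤
        newBound d r a b σ δ (sdAt k σ x (n + 1) ω (x (n + 1) ω)) (n + 1) q := by
      refine regret_le (n := n) (φ := fun z => f z ω) (k := k) (X := samples x (n + 1) ω)
        (y := observations f ε x (n + 1) ω) (w := w) hq.α_le (hx.argmax (n + 1) (by omega) ω) hwD
        (h.c2_le_postSD (fun i : Fin n => X i) ⟨w, hwD⟩) ?_ ?_ ?_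
      · refine (le_abs_self _).trans ((hlip xstar hxs w hwD).trans ?_)
        rw [← mul_discRadius hb hlogL]
        gcongr
      · rw [hY, ← hevF ω hc (X n)]
        exact hlow
      · rw [hY, ← hevF ω hc ⟨w, hwD⟩]
        exact hup ⟨w, hwD⟩ (Finset.mem_subtype.2 hwS)
    -- The confidence bounds hold for the near-optimal `q`, not for the solution `p`; passing
    -- between them costs `ρ`.
    refine hmain.trans ?_
    have := hopt p hp.1
    rw [newBound_eq, newBound_eq]
    change _ + objective σ (postSD K σ (fun i : Fin n => X i) (X n)) (n + 1) q
      ≤ _ + objective σ (postSD K σ (fun i : Fin n => X i) (X n)) (n + 1) p + ρ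
    linarith
  · refine (measure_union_le _ _).trans ?_
    rw [hcont, zero_add, ← tsum_budget hδ₀ hnL]
    refine (measure_union_le _ _).trans (add_le_add hLip ((measure_iUnion_le _).trans ?_))
    exact ENNReal.tsum_le_tsum hBad

/-- The regret bound with probability at least `1 - δ`. -/
lemma regret_holdsWithProbAtLeast {Ω : Type*} [MeasurableSpace Ω] {P : Measure Ω}
    [IsProbabilityMeasure P] {d : ℕ} {D : Set (Fin d → ℝ)} {r a b σ δ nL : ℝ}
    {k : (Fin d → ℝ) → (Fin d → ℝ) → ℝ} {f : (Fin d → ℝ) → Ω → ℝ} {ε : ℕ → Ω → ℝ}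
    {x : ℕ → Ω → (Fin d → ℝ)} (hB : BayesianSetting P D r a b σ k f ε)
    (hδ₀ : 0 < δ) (hnL : 1 < nL) (hlogL : 1 < nL * d * a / δ)
    (hD : ∀ t : ℕ, 1 ≤ t → ∀ s : ℝ, 0 < s → ∃ S, IsDiscretization D r a b δ nL t s S)
    (hx : IsGPUCB D r a b σ δ k f ε x) :
    HoldsWithProbAtLeast P (1 - δ) (fun ω => ∃ xstar ∈ D, IsMaxOn (fun z => f z ω) D xstar ∧
      ∀ t : ℕ, 1 ≤ t → ∀ p : Params, IsSolution d r a b σ δ nL (sdAt k σ x t ω (x t ω)) t p →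
        f xstar ω - f (x t ω) ω ≤ newBound d r a b σ δ (sdAt k σ x t ω (x t ω)) t p) := by
  let Good : ℕ → Ω → Prop := fun m ω => ContinuousOn (fun z => f z ω) D ∧
    ∀ xstar ∈ D, ∀ t : ℕ, 1 ≤ t → ∀ p : Params,
      IsSolution d r a b σ δ nL (sdAt k σ x t ω (x t ω)) t p →
      f xstar ω - f (x t ω) ω
        ≤ newBound d r a b σ δ (sdAt k σ x t ω (x t ω)) t p + 1 / ((m : ℝ) + 1)
  let N : ℕ → Set Ω := fun m => {ω | ¬ Good m ω}
  -- Failure sets grow as the error `1/(m+1)` shrinks, so continuity from below, valid for outer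
  -- measure too, keeps the bound `δ` in the limit.
  have hmono : Monotone N := by
    intro m m' hmm ω hω hg
    refine hω ⟨hg.1, fun xs hxs t ht p hp => (hg.2 xs hxs t ht p hp).trans ?_⟩
    have : 1 / ((m' : ℝ) + 1) ≤ 1 / ((m : ℝ) + 1) := by gcongr
    linarith
  have hN : P (⋃ m, N m) ≤ ENNReal.ofReal δ := by
    rw [hmono.measure_iUnion]
    exact iSup_le fun m => measure_regret_failure_le hB hδ₀ hnL hlogL hD hx (by positivity)
  refine ⟨(toMeasurable P (⋃ m, N m))ᶜ, (measurableSet_toMeasurable _ _).compl, ?_, fun ω hω => ?_⟩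
  · rw [prob_compl_eq_one_sub (measurableSet_toMeasurable _ _), measure_toMeasurable,
      ENNReal.ofReal_sub _ hδ₀.le, ENNReal.ofReal_one]
    exact tsub_le_tsub_left hN 1
  · have hω' : ∀ m, Good m ω := by
      intro m
      by_contra hm
      exact hω (subset_toMeasurable P _ (Set.mem_iUnion.2 ⟨m, hm⟩))
    obtain ⟨xs, hxs, hmax⟩ := hB.compact.exists_isMaxOn ⟨_, hx.mem 1 le_rfl ω⟩ (hω' 0).1
    refine ⟨xs, hxs, hmax, fun t ht p hp => ?_⟩
    refine ge_of_tendsto' (x := Filter.atTop) ?_ (fun m : ℕ => (hω' m).2 xs hxs t ht p hp)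
    simpa using tendsto_one_div_add_atTop_nhds_zero_nat.const_add
      (newBound d r a b σ δ (sdAt k σ x t ω (x t ω)) t p)

end GPUCB

/-! ### The theorem -/

theorem mainTheorem1 {Ω : Type*} [MeasurableSpace Ω] (P : Measure Ω) [IsProbabilityMeasure P]
    {d : ℕ} (D : Set (Fin d → ℝ)) (r a b σ δ nL : ℝ)
    (k : (Fin d → ℝ) → (Fin d → ℝ) → ℝ)
    (f : (Fin d → ℝ) → Ω → ℝ) (ε : ℕ → Ω → ℝ) (x : ℕ → Ω → (Fin d → ℝ))
    (hB : GPUCB.BayesianSetting P D r a b σ k f ε)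
    (hδ₀ : 0 < δ) (hδ₁ : δ < 1) (hnL : 1 < nL)
    (hlogβ : 1 < 4 * d * a / δ) (hlogL : 1 < nL * d * a / δ)
    (hD : D = Set.Icc 0 (fun _ => r) ∨
      ∀ t : ℕ, 1 ≤ t → ∀ s : ℝ, 0 < s → ∃ S, GPUCB.IsDiscretization D r a b δ nL t s S)
    (hx : GPUCB.IsGPUCB D r a b σ δ k f ε x) :
    GPUCB.HoldsWithProbAtLeast P (1 - δ) (fun ω =>
      ∃ xstar ∈ D, IsMaxOn (fun z => f z ω) D xstar ∧
        ∀ t : ℕ, 1 ≤ t → ∀ p : GPUCB.Params,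
          GPUCB.IsSolution d r a b σ δ nL (GPUCB.sdAt k σ x t ω (x t ω)) t p →
          f xstar ω - f (x t ω) ω
            ≤ GPUCB.newBound d r a b σ δ (GPUCB.sdAt k σ x t ω (x t ω)) t p) ∧
    (nL = 4 → 1 ≤ d * b * r * √(Real.log (4 * d * a / δ)) →
      ∀ t : ℕ, 1 ≤ t →
        (∃ nη nα : ℝ, GPUCB.Feasible d r a b δ nL t
          ⟨nη, nα, 2, GPUCB.beta d r a b δ t, GPUCB.beta d r a b δ t⟩) ∧
        ∀ (ω : Ω) (p : GPUCB.Params),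
          GPUCB.IsSolution d r a b σ δ nL (GPUCB.sdAt k σ x t ω (x t ω)) t p →
          GPUCB.newBound d r a b σ δ (GPUCB.sdAt k σ x t ω (x t ω)) t p
            ≤ 2 * √(GPUCB.beta d r a b δ t) * GPUCB.sdAt k σ x t ω (x t ω)
              + 1 / (t : ℝ) ^ 2) := by
  have hD' : ∀ t : ℕ, 1 ≤ t → ∀ s : ℝ, 0 < s → ∃ S, GPUCB.IsDiscretization D r a b δ nL t s S := by
    rcases hD with rfl | hD
    · exact fun t ht s _ => GPUCB.exists_isDiscretization_cube hB.r_pos hB.b_pos hlogL ht s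
    · exact hD
  refine ⟨GPUCB.regret_holdsWithProbAtLeast hB hδ₀ hnL hlogL hD' hx, ?_⟩
  rintro rfl hC t ht
  obtain ⟨nη, nα, hfeas⟩ := GPUCB.feasible_classical hB.r_pos hB.b_pos hδ₀ hδ₁ hlogβ hC ht
  exact ⟨⟨nη, nα, hfeas⟩, fun ω p hp => GPUCB.newBound_le_classical hp hfeas⟩
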